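/- **Proposition (Liouville's theorem).** Let $d\ge 1$, $s\in(0,1)$, $\lambda,\Lambda>0$ and $\rho\ge 0$. Write $B_r(x)\subset\mathbb R^d$ for the open ball and $B_r=B_r(0)$. Let $\mathcal K_\rho$ be the class of all measurable kernels $K:\mathbb R^d\to[0,\infty)$ such that $$K(y)\ge\lambda\min\{|y|^{-d-2s},\rho^{-d-2s}\}\ \text{ for all } y\ne0,\qquad \int_{B_{2r}\setminus B_r}K(y)\,dy\le\Lambda r^{-2s}\ \text{ for all } r>0,$$ with the convention $\rho^{-d-2s}=\infty$ if $\rho=0$, and, in the case $s=1/2$, also $\int_{B_{2r}\setminus B_r}yK(y)\,dy=0$ for all $r>0$. (For $\rho>0$ the class may contain integrable kernels.) Define $$\delta_yw(x)=\begin{cases}w(x+y)-w(x),& s<1/2,\\ w(x+y)-w(x)-y\cdot\nabla w(x)\mathbf 1_{B_1}(y),& s=1/2,\\ w(x+y)-w(x)-y\cdot\nabla w(x),& s>1/2,\end{cases}\qquad L_Kw(x)=\int_{\mathbb R^d}\delta_yw(x)K(y)\,dy,$$ and the Pucci extremal operators $\mathcal M_\rho^+w(x)=\sup_{K\in\mathcal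 K_\rho}L_Kw(x)$ and $\mathcal M_\rho^-w(x)=\inf_{K\in\mathcal K_\rho}L_Kw(x)$, the supremum and infimum being taken in $[-\infty,\infty]$. A function $u\in L^\infty(\mathbb R^d\times(-\infty,0])$ that is upper semicontinuous satisfies $\partial_tu-\mathcal M_\rho^+u\le0$ in $\mathbb R^d\times(-\infty,0]$ in the viscosity sense if the following holds for every $(x_0,t_0)\in\mathbb R^d\times(-\infty,0]$, every $\varepsilon>0$ and every $\varphi:B_\varepsilon(x_0)\times(t_0-\varepsilon,t_0]\to\mathbb R$ that is left-differentiable in time, $C^{1,1}$ in space, and satisfies $\varphi(x_0,t_0)=u(x_0,t_0)$ and $u\le\varphi$ in $B_\varepsilon(x_0)\times(t_0-\varepsilon,t_0]$: the function $v$ that equals $\varphi$ in $B_\varepsilon(x_0)\times(t_0-\varepsilon,t_0]$ and $u$ elsewhere satisfies $\partial_tv(x_0,t_0)-\mathcal M_\rho^+v(x_0,t_0)\le0$, where $\partial_t$ is the left derivative in time and $\mathcal M_\rho^\pm$ acts in the space variable. Similarly, a lower semicontinuous $u\in L^\infty(\mathbb R^d\times(-\infty,0])$ satisfies $\partial_tu-\mathcal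 M_\rho^-u\ge0$ in the viscosity sense if the same holds with $u\ge\varphi$ in place of $u\le\varphi$ and with the conclusion $\partial_tv(x_0,t_0)-\mathcal M_\rho^-v(x_0,t_0)\ge0$. If $u\in L^\infty(\mathbb R^d\times(-\infty,0])$ satisfies both $$\partial_tu-\mathcal M_\rho^+u\le0\quad\text{and}\quad\partial_tu-\mathcal M_\rho^-u\ge0\quad\text{in }\mathbb R^d\times(-\infty,0]$$ in the viscosity sense, then $u$ is constant in $\mathbb R^d\times(-\infty,0]$. -/

import Mathlib

open Set MeasureTheory
open scoped NNReal ENNReal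

noncomputable section

/-- The lower bound `min {|y|^(-d-2s), ρ^(-d-2s)}` on the kernels, where by convention
`ρ^(-d-2s) = ∞` if `ρ = 0`. -/
def lowerKernel (d : ℕ) (s ρ : ℝ) (y : EuclideanSpace ℝ (Fin d)) : ℝ :=
  if ρ = 0 then ‖y‖ ^ (-(d : ℝ) - 2 * s)
  else min (‖y‖ ^ (-(d : ℝ) - 2 * s)) (ρ ^ (-(d : ℝ) - 2 * s))

/-- The annulus `B_{2r} \ B_r` around the origin. -/
def annulus (d : ℕ) (r : ℝ) : Set (EuclideanSpace ℝ (Fin d)) :=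
  Metric.ball 0 (2 * r) \ Metric.ball 0 r

/-- The class `𝒦_ρ` of admissible kernels with ellipticity constants `lam`, `Lam`.
Integrability on every annulus says that the kernel is measurable and that the integral in the
upper bound is a finite Lebesgue integral. -/
structure IsAdmissibleKernel (d : ℕ) (s lam Lam ρ : ℝ)
    (K : EuclideanSpace ℝ (Fin d) → ℝ) : Prop where
  nonneg : ∀ y, 0 ≤ K y
  lower : ∀ y, y ≠ 0 → lam * lowerKernel d s ρ y ≤ K y
  integrableOn : ∀ r : ℝ, 0 < r → IntegrableOn K (annulus d r) volume
  upper : ∀ r : ℝ, 0 < r → ∫ y in annulus d r, K y ≤ Lam * r ^ (-(2 * s))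
  symm : s = 1 / 2 → ∀ r : ℝ, 0 < r → ∫ y in annulus d r, K y • y = 0

/-- The difference operator `δ_y w(x)`, depending on the order `2s`. -/
def diffOp {d : ℕ} (s : ℝ) (w : EuclideanSpace ℝ (Fin d) → ℝ)
    (x y : EuclideanSpace ℝ (Fin d)) : ℝ :=
  if s < 1 / 2 then w (x + y) - w x
  else if s = 1 / 2 then
    w (x + y) - w x - (Metric.ball 0 1).indicator (fun z => inner ℝ z (gradient w x)) y
  else w (x + y) - w x - inner ℝ y (gradient w x)

/-- The integro-differential operator `L_K w(x) = ∫ δ_y w(x) K(y) dy`. -/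
def levyOp {d : ℕ} (s : ℝ) (K w : EuclideanSpace ℝ (Fin d) → ℝ)
    (x : EuclideanSpace ℝ (Fin d)) : ℝ :=
  ∫ y, diffOp s w x y * K y

/-- The Pucci extremal operator `ℳ_ρ⁺ w(x) = sup_{K ∈ 𝒦_ρ} L_K w(x)`, a supremum of real
numbers taken in the extended reals. -/
def pucciSup {d : ℕ} (s lam Lam ρ : ℝ) (w : EuclideanSpace ℝ (Fin d) → ℝ)
    (x : EuclideanSpace ℝ (Fin d)) : EReal :=
  ⨆ (K : EuclideanSpace ℝ (Fin d) → ℝ) (_ : IsAdmissibleKernel d s lam Lam ρ K),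
    ((levyOp s K w x : ℝ) : EReal)

/-- The Pucci extremal operator `ℳ_ρ⁻ w(x) = inf_{K ∈ 𝒦_ρ} L_K w(x)`. -/
def pucciInf {d : ℕ} (s lam Lam ρ : ℝ) (w : EuclideanSpace ℝ (Fin d) → ℝ)
    (x : EuclideanSpace ℝ (Fin d)) : EReal :=
  ⨅ (K : EuclideanSpace ℝ (Fin d) → ℝ) (_ : IsAdmissibleKernel d s lam Lam ρ K),
    ((levyOp s K w x : ℝ) : EReal)

/-- The function `φ` is left-differentiable in time and `C^{1,1}` in space on the cylinder
`B_ε(x₀) × (t₀ - ε, t₀]`. Only its values there matter. -/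
structure IsTestFunction {d : ℕ} (φ : EuclideanSpace ℝ (Fin d) → ℝ → ℝ)
    (x₀ : EuclideanSpace ℝ (Fin d)) (t₀ ε : ℝ) : Prop where
  left_differentiable : ∀ x ∈ Metric.ball x₀ ε, ∀ t ∈ Ioc (t₀ - ε) t₀,
    DifferentiableWithinAt ℝ (fun τ => φ x τ) (Iic t) t
  differentiable : ∀ t ∈ Ioc (t₀ - ε) t₀,
    DifferentiableOn ℝ (fun x => φ x t) (Metric.ball x₀ ε)
  lipschitz_gradient : ∀ t ∈ Ioc (t₀ - ε) t₀, ∃ C : ℝ≥0,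
    LipschitzOnWith C (gradient (fun x => φ x t)) (Metric.ball x₀ ε)

open Classical in
/-- The function that equals `φ` in `B_ε(x₀) × (t₀ - ε, t₀]` and `u` elsewhere. -/
def glue {d : ℕ} (u φ : EuclideanSpace ℝ (Fin d) → ℝ → ℝ)
    (x₀ : EuclideanSpace ℝ (Fin d)) (t₀ ε : ℝ) (x : EuclideanSpace ℝ (Fin d)) (t : ℝ) : ℝ :=
  if x ∈ Metric.ball x₀ ε ∧ t ∈ Ioc (t₀ - ε) t₀ then φ x t else u x t

/-- The time derivative `∂_t v(x,t)` from the left. -/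
def leftTimeDeriv {d : ℕ} (v : EuclideanSpace ℝ (Fin d) → ℝ → ℝ)
    (x : EuclideanSpace ℝ (Fin d)) (t : ℝ) : ℝ :=
  derivWithin (fun τ => v x τ) (Iic t) t

/-- `u ∈ L^∞(ℝ^d × I)` is upper semicontinuous in `Ω × I` and solves `∂_t u - F(u) ≤ f` in
`Ω × I` in the viscosity sense. Here `Ω` is a domain and `I` a left-open interval. -/
structure IsViscositySubsolution {d : ℕ}
    (F : (EuclideanSpace ℝ (Fin d) → ℝ) → EuclideanSpace ℝ (Fin d) → EReal)
    (f : EuclideanSpace ℝ (Fin d) → ℝ → ℝ)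
    (Ω : Set (EuclideanSpace ℝ (Fin d))) (I : Set ℝ)
    (u : EuclideanSpace ℝ (Fin d) → ℝ → ℝ) : Prop where
  memLp_top : MemLp (fun p : EuclideanSpace ℝ (Fin d) × ℝ => u p.1 p.2) ∞
    (volume.restrict (univ ×ˢ I))
  upperSemicontinuousOn :
    UpperSemicontinuousOn (fun p : EuclideanSpace ℝ (Fin d) × ℝ => u p.1 p.2) (Ω ×ˢ I)
  le_of_touching : ∀ x₀ ∈ Ω, ∀ t₀ ∈ I, ∀ ε : ℝ, 0 < ε →
    Metric.ball x₀ ε ×ˢ Ioc (t₀ - ε) t₀ ⊆ Ω ×ˢ I →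
    ∀ φ : EuclideanSpace ℝ (Fin d) → ℝ → ℝ, IsTestFunction φ x₀ t₀ ε →
    u x₀ t₀ = φ x₀ t₀ →
    (∀ x ∈ Metric.ball x₀ ε, ∀ t ∈ Ioc (t₀ - ε) t₀, u x t ≤ φ x t) →
    ((leftTimeDeriv (glue u φ x₀ t₀ ε) x₀ t₀ : ℝ) : EReal)
      - F (fun x => glue u φ x₀ t₀ ε x t₀) x₀ ≤ ((f x₀ t₀ : ℝ) : EReal)

/-- `u ∈ L^∞(ℝ^d × I)` is lower semicontinuous in `Ω × I` and solves `∂_t u - F(u) ≥ f` in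
`Ω × I` in the viscosity sense. Here `Ω` is a domain and `I` a left-open interval. -/
structure IsViscositySupersolution {d : ℕ}
    (F : (EuclideanSpace ℝ (Fin d) → ℝ) → EuclideanSpace ℝ (Fin d) → EReal)
    (f : EuclideanSpace ℝ (Fin d) → ℝ → ℝ)
    (Ω : Set (EuclideanSpace ℝ (Fin d))) (I : Set ℝ)
    (u : EuclideanSpace ℝ (Fin d) → ℝ → ℝ) : Prop where
  memLp_top : MemLp (fun p : EuclideanSpace ℝ (Fin d) × ℝ => u p.1 p.2) ∞
    (volume.restrict (univ ×ˢ I))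
  lowerSemicontinuousOn :
    LowerSemicontinuousOn (fun p : EuclideanSpace ℝ (Fin d) × ℝ => u p.1 p.2) (Ω ×ˢ I)
  ge_of_touching : ∀ x₀ ∈ Ω, ∀ t₀ ∈ I, ∀ ε : ℝ, 0 < ε →
    Metric.ball x₀ ε ×ˢ Ioc (t₀ - ε) t₀ ⊆ Ω ×ˢ I →
    ∀ φ : EuclideanSpace ℝ (Fin d) → ℝ → ℝ, IsTestFunction φ x₀ t₀ ε →
    u x₀ t₀ = φ x₀ t₀ →
    (∀ x ∈ Metric.ball x₀ ε, ∀ t ∈ Ioc (t₀ - ε) t₀, φ x t ≤ u x t) →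
    ((f x₀ t₀ : ℝ) : EReal) ≤ ((leftTimeDeriv (glue u φ x₀ t₀ ε) x₀ t₀ : ℝ) : EReal)
      - F (fun x => glue u φ x₀ t₀ ε x t₀) x₀

end

open Set MeasureTheory
open scoped NNReal ENNReal

noncomputable section

/-! ### Moments of admissible kernels. -/

section
variable {d : ℕ} {s lam Lam ρ : ℝ} {K : EuclideanSpace ℝ (Fin d) → ℝ}

/-! The theorem follows from a weak Harnack inequality at large scales, with no Hölder iteration.
Let `M` and `M'` be the supremum and infimum of `u`. For `R ≥ ρ`, the values of `M - u` on `B_R ×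
[-R^(2s), 0]` are at least a fixed multiple of the average of `M - u` over `B_R × [-2R^(2s),
-R^(2s)]` (`exists_weak_harnack`). The same holds for `u - M'`. The two averages add up to `M - M'`,
so `c (M - M') ≤ (M - u(p)) + (u(q) - M')` for all points `p`, `q`, once `R` is large. Letting
`u(p)` tend to `M` and `u(q)` to `M'` forces `M = M'`.

The Harnack inequality comes from comparing `u` with `M - m(t) η(x)`, where `η = bump d R`. This `η`
decays polynomially, for two reasons. Its derivatives are controlled by `η` itself, so `L_K η ≥ -C
R^(-2s) η` everywhere (`exists_levyOp_ge`). Its decay `|x|^(-2(d+1))` is faster than that of the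
kernels, so the mass of `M - u` in `B_R` is felt at `x` with weight at least a multiple of
`R^(-d-2s) η(x)` (`IsAdmissibleKernel.bump_le`). Every term at a touching point thus carries the
factor `η(x₀)` (`exists_touching_inequality`), and the comparison reduces to a linear ODE for `m`
(`exists_le_sub_mul_bump`). -/

theorem measurableSet_annulus (d : ℕ) (r : ℝ) : MeasurableSet (annulus d r) :=
  measurableSet_ball.diff measurableSet_ball

theorem mem_annulus {r : ℝ} {y : EuclideanSpace ℝ (Fin d)} :
    y ∈ annulus d r ↔ r ≤ ‖y‖ ∧ ‖y‖ < 2 * r := by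
  simp [annulus, and_comm]

/-- Integral of `|y|^q K(y)` over one annulus. -/
theorem IsAdmissibleKernel.lintegral_annulus_le (hK : IsAdmissibleKernel d s lam Lam ρ K)
    (q : ℕ) {r : ℝ} (hr : 0 < r) :
    ∫⁻ y in annulus d r, ENNReal.ofReal (‖y‖ ^ q * K y)
      ≤ ENNReal.ofReal (2 ^ q * Lam * r ^ ((q : ℝ) - 2 * s)) := by
  have h1 : ∫⁻ y in annulus d r, ENNReal.ofReal (‖y‖ ^ q * K y)
      ≤ ∫⁻ y in annulus d r, ENNReal.ofReal ((2 * r) ^ q * K y) := by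
    refine setLIntegral_mono' (measurableSet_annulus d r) fun y hy => ?_
    have := (mem_annulus.1 hy).2.le
    have := hK.nonneg y
    gcongr
  refine h1.trans ?_
  have hint := (hK.integrableOn r hr).const_mul ((2 * r) ^ q)
  rw [← ofReal_integral_eq_lintegral_ofReal hint
    (Filter.Eventually.of_forall fun y => mul_nonneg (by positivity) (hK.nonneg y))]
  refine ENNReal.ofReal_le_ofReal ?_
  rw [integral_const_mul]
  calc (2 * r) ^ q * ∫ y in annulus d r, K y ≤ (2 * r) ^ q * (Lam * r ^ (-(2 * s))) := by
        gcongr; exact hK.upper r hr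
    _ = 2 ^ q * Lam * r ^ ((q : ℝ) - 2 * s) := by
        rw [sub_eq_add_neg, Real.rpow_add hr, Real.rpow_natCast]; ring

/-- The annulus bounds form a geometric series of ratio `b ^ (q - 2s)`. Taking `b = 1/2` with `q >
2s` covers balls, and `b = 2` with `q < 2s` covers their complements. -/
theorem IsAdmissibleKernel.integrableOn_iUnion_annulus (hK : IsAdmissibleKernel d s lam Lam ρ K)
    (hLam : 0 < Lam) (q : ℕ) {r b : ℝ} (hr : 0 < r) (hb : 0 < b)
    (hlt : b ^ ((q : ℝ) - 2 * s) < 1) :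
    IntegrableOn (fun y => ‖y‖ ^ q * K y) (⋃ k : ℕ, annulus d (r * b ^ k)) ∧
      ∫ y in ⋃ k : ℕ, annulus d (r * b ^ k), ‖y‖ ^ q * K y
        ≤ 2 ^ q * Lam / (1 - b ^ ((q : ℝ) - 2 * s)) * r ^ ((q : ℝ) - 2 * s) := by
  set θ := b ^ ((q : ℝ) - 2 * s) with hθ
  have hθ0 : 0 ≤ θ := by positivity
  have hnn : ∀ y, 0 ≤ ‖y‖ ^ q * K y := fun y => mul_nonneg (by positivity) (hK.nonneg y)
  have hlin : ∫⁻ y in ⋃ k : ℕ, annulus d (r * b ^ k), ENNReal.ofReal (‖y‖ ^ q * K y)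
      ≤ ENNReal.ofReal (2 ^ q * Lam / (1 - θ) * r ^ ((q : ℝ) - 2 * s)) := by
    refine (lintegral_iUnion_le _ _).trans ?_
    refine (ENNReal.tsum_le_tsum fun k =>
      hK.lintegral_annulus_le q (by positivity : 0 < r * b ^ k)).trans ?_
    have hk : ∀ k : ℕ, 2 ^ q * Lam * (r * b ^ k) ^ ((q : ℝ) - 2 * s)
        = 2 ^ q * Lam * r ^ ((q : ℝ) - 2 * s) * θ ^ k := fun k => by
      rw [Real.mul_rpow hr.le (by positivity), hθ, Real.rpow_pow_comm hb.le]
      ring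
    simp_rw [hk]
    rw [← ENNReal.ofReal_tsum_of_nonneg (fun k => by positivity)
      ((summable_geometric_of_lt_one hθ0 hlt).mul_left _), tsum_mul_left,
      tsum_geometric_of_lt_one hθ0 hlt]
    exact ENNReal.ofReal_le_ofReal (le_of_eq (by ring))
  have hmeas : AEStronglyMeasurable (fun y => ‖y‖ ^ q * K y)
      (volume.restrict (⋃ k : ℕ, annulus d (r * b ^ k))) := by
    rw [aestronglyMeasurable_iUnion_iff]
    intro k
    exact (by fun_prop : Continuous fun y : EuclideanSpace ℝ (Fin d) => ‖y‖ ^ q)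
      |>.aestronglyMeasurable.mul (hK.integrableOn _ (by positivity)).1
  have hint : IntegrableOn (fun y => ‖y‖ ^ q * K y) (⋃ k : ℕ, annulus d (r * b ^ k)) := by
    refine ⟨hmeas, ?_⟩
    rw [hasFiniteIntegral_iff_ofReal (Filter.Eventually.of_forall hnn)]
    exact hlin.trans_lt ENNReal.ofReal_lt_top
  refine ⟨hint, ?_⟩
  rw [integral_eq_lintegral_of_nonneg_ae (Filter.Eventually.of_forall hnn) hmeas]
  refine ENNReal.toReal_le_of_le_ofReal ?_ hlin
  have : 0 < 1 - θ := by linarith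
  positivity

theorem ball_subset_iUnion_annulus {R : ℝ} (hR : 0 < R) :
    Metric.ball (0 : EuclideanSpace ℝ (Fin d)) R \ {0}
      ⊆ ⋃ k : ℕ, annulus d (R / 2 * (1 / 2) ^ k) := by
  rintro y ⟨hy, hy0⟩
  rw [mem_ball_zero_iff] at hy
  have hy0 : 0 < ‖y‖ := norm_pos_iff.2 hy0
  obtain ⟨k, hk1, hk2⟩ := exists_nat_pow_near_of_lt_one (x := ‖y‖ / R) (y := 1 / 2)
    (by positivity) (by rw [div_le_one hR]; exact hy.le) (by norm_num) (by norm_num)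
  -- The annuli are closed on the inside and open on the outside, so on equality `y` belongs to the
  -- next larger annulus; `k = 0` is excluded because the ball is open.
  by_cases h : ‖y‖ / R = (1 / 2) ^ k
  · obtain _ | k := k
    · rw [pow_zero, div_eq_one_iff_eq hR.ne'] at h
      linarith
    · refine mem_iUnion.2 ⟨k, mem_annulus.2 ?_⟩
      have := pow_pos (by norm_num : (0 : ℝ) < 1 / 2) k
      rw [div_eq_iff hR.ne', pow_succ] at h
      constructor <;> nlinarith
  · refine mem_iUnion.2 ⟨k, mem_annulus.2 ?_⟩
    have hk2 := lt_of_le_of_ne hk2 h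
    rw [lt_div_iff₀ hR, pow_succ] at hk1
    rw [div_lt_iff₀ hR] at hk2
    constructor <;> nlinarith

theorem compl_ball_subset_iUnion_annulus {R : ℝ} (hR : 0 < R) :
    (Metric.ball (0 : EuclideanSpace ℝ (Fin d)) R)ᶜ ⊆ ⋃ k : ℕ, annulus d (R * 2 ^ k) := by
  intro y hy
  rw [mem_compl_iff, mem_ball_zero_iff, not_lt] at hy
  obtain ⟨k, hk1, hk2⟩ := exists_nat_pow_near (x := ‖y‖ / R) (y := 2)
    (by rwa [one_le_div hR]) (by norm_num)
  refine mem_iUnion.2 ⟨k, mem_annulus.2 ?_⟩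
  rw [le_div_iff₀ hR] at hk1
  rw [div_lt_iff₀ hR, pow_succ] at hk2
  constructor <;> nlinarith

/-- Moments of order `q > 2s` are controlled in balls. -/
theorem exists_moment_ball_le (hd : 1 ≤ d) (lam ρ : ℝ) (hLam : 0 < Lam) {q : ℕ}
    (hq : 2 * s < q) :
    ∃ C : ℝ, 0 ≤ C ∧ ∀ K : EuclideanSpace ℝ (Fin d) → ℝ, IsAdmissibleKernel d s lam Lam ρ K →
      ∀ R : ℝ, 0 < R → IntegrableOn (fun y => ‖y‖ ^ q * K y) (Metric.ball 0 R) ∧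
        ∫ y in Metric.ball 0 R, ‖y‖ ^ q * K y ≤ C * R ^ ((q : ℝ) - 2 * s) := by
  have hlt : (1 / 2 : ℝ) ^ ((q : ℝ) - 2 * s) < 1 :=
    Real.rpow_lt_one (by norm_num) (by norm_num) (by linarith)
  have hpos := sub_pos.2 hlt
  have : Nonempty (Fin d) := ⟨⟨0, hd⟩⟩
  refine ⟨2 ^ q * Lam / (1 - (1 / 2) ^ ((q : ℝ) - 2 * s)) * (1 / 2) ^ ((q : ℝ) - 2 * s),
    by positivity, fun K hK R hR => ?_⟩
  obtain ⟨h1, h2⟩ := hK.integrableOn_iUnion_annulus hLam q (half_pos hR)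
    (by norm_num : (0 : ℝ) < 1 / 2) hlt
  have hsub : Metric.ball (0 : EuclideanSpace ℝ (Fin d)) R
      ≤ᵐ[volume] ⋃ k : ℕ, annulus d (R / 2 * (1 / 2) ^ k) := by
    have h0 : ∀ᵐ y : EuclideanSpace ℝ (Fin d), y ≠ 0 := by
      simp [ae_iff]
    filter_upwards [h0] with y hy hyR
    exact ball_subset_iUnion_annulus hR ⟨hyR, hy⟩
  refine ⟨h1.mono_set_ae hsub, ?_⟩
  refine (setIntegral_mono_set h1 (Filter.Eventually.of_forall fun y =>
    mul_nonneg (by positivity) (hK.nonneg y)) hsub).trans (h2.trans (le_of_eq ?_))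
  rw [div_eq_mul_inv R 2, Real.mul_rpow hR.le (by norm_num), one_div]
  ring

/-- Moments of order `q < 2s` are controlled outside balls. -/
theorem exists_moment_compl_ball_le (lam ρ : ℝ) (hLam : 0 < Lam) {q : ℕ} (hq : (q : ℝ) < 2 * s) :
    ∃ C : ℝ, 0 ≤ C ∧ ∀ K : EuclideanSpace ℝ (Fin d) → ℝ, IsAdmissibleKernel d s lam Lam ρ K →
      ∀ R : ℝ, 0 < R → IntegrableOn (fun y => ‖y‖ ^ q * K y) (Metric.ball 0 R)ᶜ ∧
        ∫ y in (Metric.ball 0 R)ᶜ, ‖y‖ ^ q * K y ≤ C * R ^ ((q : ℝ) - 2 * s) := by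
  have hlt : (2 : ℝ) ^ ((q : ℝ) - 2 * s) < 1 :=
    Real.rpow_lt_one_of_one_lt_of_neg (by norm_num) (by linarith)
  have hpos := sub_pos.2 hlt
  refine ⟨2 ^ q * Lam / (1 - 2 ^ ((q : ℝ) - 2 * s)), by positivity, fun K hK R hR => ?_⟩
  obtain ⟨h1, h2⟩ := hK.integrableOn_iUnion_annulus hLam q hR (by norm_num : (0 : ℝ) < 2) hlt
  have hsub := compl_ball_subset_iUnion_annulus (d := d) hR
  refine ⟨h1.mono_set hsub, ?_⟩
  exact (setIntegral_mono_set h1 (Filter.Eventually.of_forall fun y =>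
    mul_nonneg (by positivity) (hK.nonneg y)) hsub.eventuallyLE).trans h2

/-- Measurability is known annulus by annulus, and dyadic annuli cover everything but the origin, a
null set since `d ≥ 1`. -/
theorem IsAdmissibleKernel.aestronglyMeasurable (hd : 1 ≤ d)
    (hK : IsAdmissibleKernel d s lam Lam ρ K) : AEStronglyMeasurable K volume := by
  have : Nonempty (Fin d) := ⟨⟨0, hd⟩⟩
  have h1 : AEStronglyMeasurable K (volume.restrict
      ((⋃ k : ℕ, annulus d (1 / 2 * (1 / 2) ^ k)) ∪ ⋃ k : ℕ, annulus d (1 * 2 ^ k))) := by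
    rw [aestronglyMeasurable_union_iff, aestronglyMeasurable_iUnion_iff,
      aestronglyMeasurable_iUnion_iff]
    exact ⟨fun k => (hK.integrableOn _ (by positivity)).1,
      fun k => (hK.integrableOn _ (by positivity)).1⟩
  have h0 : ∀ᵐ y : EuclideanSpace ℝ (Fin d), y ≠ 0 := by
    simp [ae_iff]
  rwa [Measure.restrict_eq_self_of_ae_mem] at h1
  filter_upwards [h0] with y hy
  by_cases hy1 : y ∈ Metric.ball (0 : EuclideanSpace ℝ (Fin d)) 1
  · exact Or.inl (ball_subset_iUnion_annulus one_pos ⟨hy1, hy⟩)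
  · exact Or.inr (compl_ball_subset_iUnion_annulus one_pos hy1)

/-- For `s = 1/2` the first moment vanishes on all dyadic rings around the unit ball. -/
theorem IsAdmissibleKernel.integral_smul_ring_eq_zero
    (hK : IsAdmissibleKernel d s lam Lam ρ K) (hs : s = 1 / 2) (k : ℕ) :
    IntegrableOn (fun y => K y • y) (Metric.ball 0 (2 ^ k) \ Metric.ball 0 1) ∧
      ∫ y in Metric.ball 0 (2 ^ k) \ Metric.ball 0 1, K y • y = 0 := by
  induction k with
  | zero => simp
  | succ k ih =>
    have h2 : (1 : ℝ) ≤ 2 ^ k := one_le_pow₀ (by norm_num)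
    have hset : Metric.ball (0 : EuclideanSpace ℝ (Fin d)) (2 ^ (k + 1)) \ Metric.ball 0 1
        = (Metric.ball 0 (2 ^ k) \ Metric.ball 0 1) ∪ annulus d (2 ^ k) := by
      ext y
      simp only [mem_union, mem_annulus, mem_sdiff, mem_ball_zero_iff, not_lt, pow_succ]
      constructor
      · rintro ⟨h3, h4⟩
        by_cases h : ‖y‖ < 2 ^ k
        · exact Or.inl ⟨h, h4⟩
        · exact Or.inr ⟨not_lt.1 h, by linarith⟩
      · rintro (⟨h3, h4⟩ | ⟨h3, h4⟩) <;> constructor <;> linarith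
    have hann : IntegrableOn (fun y => K y • y) (annulus d (2 ^ k)) := by
      have h := hK.integrableOn (2 ^ k) (by positivity)
      refine Integrable.mono' (h.const_mul (2 * 2 ^ k))
        (h.1.smul continuous_id.aestronglyMeasurable) ?_
      refine (ae_restrict_iff' (measurableSet_annulus d _)).2 (Filter.Eventually.of_forall ?_)
      intro y hy
      rw [norm_smul, Real.norm_of_nonneg (hK.nonneg y), mul_comm]
      exact mul_le_mul_of_nonneg_right (mem_annulus.1 hy).2.le (hK.nonneg y)
    rw [hset]
    refine ⟨ih.1.union hann, ?_⟩
    rw [setIntegral_union _ (measurableSet_annulus d _) ih.1 hann, ih.2,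
      hK.symm hs _ (by positivity), add_zero]
    rw [Set.disjoint_left]
    intro y hy hy2
    exact absurd (mem_annulus.1 hy2).1 (not_le.2 (mem_ball_zero_iff.1 hy.1))

end

/-! ### The spatial barrier and its differential inequalities. -/

/-- A smooth positive function of height one that lives in `B_R` and decays polynomially. -/
def bump (d : ℕ) (R : ℝ) (x : EuclideanSpace ℝ (Fin d)) : ℝ :=
  ((1 + ‖x‖ ^ 2 / R ^ 2) ^ (d + 1))⁻¹

section bump
variable {d : ℕ} {R : ℝ}

theorem bump_pos (x : EuclideanSpace ℝ (Fin d)) : 0 < bump d R x := by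
  unfold bump; positivity

theorem bump_le_inv (x : EuclideanSpace ℝ (Fin d)) : bump d R x ≤ (1 + ‖x‖ ^ 2 / R ^ 2)⁻¹ := by
  have h : (1 : ℝ) ≤ 1 + ‖x‖ ^ 2 / R ^ 2 := le_add_of_nonneg_right (by positivity)
  exact inv_anti₀ (by positivity) (le_self_pow₀ h (by omega))

theorem bump_le_one (x : EuclideanSpace ℝ (Fin d)) : bump d R x ≤ 1 :=
  (bump_le_inv x).trans (inv_le_one_of_one_le₀ (le_add_of_nonneg_right (by positivity)))

theorem bump_ge_of_norm_le (hR : 0 < R) {x : EuclideanSpace ℝ (Fin d)} (hx : ‖x‖ ≤ R) :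
    (2 ^ (d + 1))⁻¹ ≤ bump d R x := by
  unfold bump
  have : ‖x‖ ^ 2 / R ^ 2 ≤ 1 := by
    rw [div_le_one (by positivity)]; gcongr
  gcongr
  linarith

/-- Confines the maximum in the comparison argument to a compact set. -/
theorem exists_bump_lt (hR : 0 < R) {c : ℝ} (hc : 0 < c) :
    ∃ r : ℝ, ∀ x : EuclideanSpace ℝ (Fin d), r < ‖x‖ → bump d R x < c := by
  refine ⟨R / Real.sqrt c, fun x hx => (bump_le_inv x).trans_lt ?_⟩
  have hsc := Real.sqrt_pos.2 hc
  rw [inv_lt_comm₀ (by positivity) hc]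
  have h1 : (R / Real.sqrt c) ^ 2 < ‖x‖ ^ 2 := by gcongr
  rw [div_pow, Real.sq_sqrt hc.le, div_lt_iff₀ hc] at h1
  have h2 : c⁻¹ < ‖x‖ ^ 2 / R ^ 2 := by
    rw [inv_eq_one_div, div_lt_div_iff₀ hc (by positivity)]; linarith
  linarith

theorem contDiff_bump : ContDiff ℝ 2 (bump d R) := by
  unfold bump
  refine ContDiff.inv ?_ fun x => by positivity
  exact (contDiff_const.add ((contDiff_norm_sq ℝ).div_const _)).pow _

theorem hasGradientAt_bump (x : EuclideanSpace ℝ (Fin d)) :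
    HasGradientAt (bump d R)
      (-(2 * (d + 1) / R ^ 2 * bump d R x / (1 + ‖x‖ ^ 2 / R ^ 2)) • x) x := by
  rw [hasGradientAt_iff_hasFDerivAt]
  have h1 : HasFDerivAt (fun z : EuclideanSpace ℝ (Fin d) => ‖z‖ ^ 2)
      (2 • (innerSL ℝ x)) x := by
    simpa using (hasFDerivAt_id x).norm_sq
  have hpos : 0 < 1 + ‖x‖ ^ 2 / R ^ 2 := by positivity
  have h2 : HasDerivAt (fun z : ℝ => ((1 + z / R ^ 2) ^ (d + 1))⁻¹)
      (-(((d + 1 : ℕ) : ℝ) * (1 + ‖x‖ ^ 2 / R ^ 2) ^ d * (1 / R ^ 2))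
        / ((1 + ‖x‖ ^ 2 / R ^ 2) ^ (d + 1)) ^ 2) (‖x‖ ^ 2) :=
    ((((hasDerivAt_id _).div_const _).const_add 1).pow (d + 1)).inv (by simp; positivity)
  refine (h2.comp_hasFDerivAt x h1).congr_fderiv ?_
  ext y
  simp only [smul_apply, innerSL_apply_apply, map_smul,
    InnerProductSpace.toDual_apply_apply, smul_eq_mul, nsmul_eq_mul, bump]
  push_cast
  field_simp
  ring

/-- The factor `|x| / R` in the gradient is absorbed by `2t ≤ 1 + t²`. It matters that the bound is
proportional to `bump d R x`, not merely to `1 / R`. -/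
theorem norm_gradient_bump_le (hR : 0 < R) (x : EuclideanSpace ℝ (Fin d)) :
    ‖gradient (bump d R) x‖ ≤ (d + 1) * bump d R x / R := by
  rw [(hasGradientAt_bump x).gradient, norm_smul, norm_neg]
  have h0 := bump_pos (R := R) x
  rw [Real.norm_of_nonneg (by positivity)]
  have h1 : ‖x‖ / R * 2 ≤ 1 + ‖x‖ ^ 2 / R ^ 2 := by
    rw [← div_pow]; nlinarith [sq_nonneg (‖x‖ / R - 1)]
  have h2 : (d + 1) * bump d R x / R * (‖x‖ / R * 2) ≤
      (d + 1) * bump d R x / R * (1 + ‖x‖ ^ 2 / R ^ 2) := by gcongr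
  rw [div_mul_eq_mul_div, div_le_iff₀ (by positivity)]
  refine le_trans (le_of_eq ?_) h2
  field_simp

/-- Convexity of `r ↦ r^(-(d+1))` on the positive axis puts `bump` above its tangent in the variable
`1 + |x|²/R²`. The part of the increment linear in `y` is the gradient term; the rest is quadratic.
No restriction on the size of `y` is needed. -/
theorem bump_add_ge (hR : 0 < R) (x y : EuclideanSpace ℝ (Fin d)) :
    bump d R x + inner ℝ y (gradient (bump d R) x) - (d + 1) * bump d R x * (‖y‖ ^ 2 / R ^ 2)
      ≤ bump d R (x + y) := by
  rw [(hasGradientAt_bump x).gradient, inner_smul_right]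
  set a := 1 + ‖x + y‖ ^ 2 / R ^ 2 with ha
  set b := 1 + ‖x‖ ^ 2 / R ^ 2 with hb
  have ha0 : 0 < a := by positivity
  have hb0 : 0 < b := by positivity
  have hb1 : 1 ≤ b := le_add_of_nonneg_right (by positivity)
  have hbx : bump d R x = (b ^ (d + 1))⁻¹ := rfl
  have hba : bump d R (x + y) = bump d R x * (b / a) ^ (d + 1) := by
    rw [hbx]; unfold bump; rw [← ha, div_pow]; field_simp
  -- The tangent line at `r = 1`, evaluated at `r = a / b`, from `exp x ≥ 1 + x` and `log x ≥ 1 -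
  -- 1/x`.
  have hlog : (b / a) ^ (d + 1) ≥ 1 - (d + 1) * (a / b - 1) := by
    have hq : 0 < b / a := by positivity
    have h1 : (b / a) ^ (d + 1) = Real.exp ((d + 1 : ℕ) * Real.log (b / a)) := by
      rw [Real.exp_nat_mul, Real.exp_log hq]
    have h2 := Real.add_one_le_exp ((d + 1 : ℕ) * Real.log (b / a))
    have h3 := Real.one_sub_inv_le_log_of_pos hq
    rw [inv_div] at h3
    have h4 : ((d + 1 : ℕ) : ℝ) * (1 - a / b) ≤ (d + 1 : ℕ) * Real.log (b / a) := by gcongr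
    push_cast at h1 h2 h4
    rw [h1]
    linarith
  have hab : a / b - 1 = (2 * inner ℝ y x + ‖y‖ ^ 2) / R ^ 2 / b := by
    rw [div_sub_one hb0.ne', ha, hb, norm_add_sq_real, real_inner_comm]; ring
  have h0 := bump_pos (R := R) x
  rw [hba]
  have h2 : ‖y‖ ^ 2 / R ^ 2 / b ≤ ‖y‖ ^ 2 / R ^ 2 := div_le_self (by positivity) hb1
  calc _ ≤ bump d R x * (1 - (d + 1) * ((2 * inner ℝ y x + ‖y‖ ^ 2) / R ^ 2 / b)) := by
        have h3 : (d + 1) * bump d R x * (‖y‖ ^ 2 / R ^ 2 / b)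
          ≤ (d + 1) * bump d R x * (‖y‖ ^ 2 / R ^ 2) := by gcongr
        have h4 : -(2 * (d + 1) / R ^ 2 * bump d R x / b) * inner ℝ y x =
          - (bump d R x * ((d + 1) * (2 * inner ℝ y x / R ^ 2 / b))) := by ring
        rw [h4, add_div, add_div]
        nlinarith
    _ ≤ _ := by rw [← hab]; gcongr

end bump

/-! ### Second-order Taylor bounds for `C²` functions. -/

section Taylor
variable {E : Type*} [NormedAddCommGroup E] [InnerProductSpace ℝ E] [CompleteSpace E]

theorem norm_gradient_sub_gradient (f : E → ℝ) (x y : E) :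
    ‖gradient f x - gradient f y‖ = ‖fderiv ℝ f x - fderiv ℝ f y‖ := by
  unfold gradient
  rw [← map_sub, LinearIsometryEquiv.norm_map]

theorem ContDiff.exists_lipschitzOnWith_gradient [ProperSpace E] {f : E → ℝ}
    (hf : ContDiff ℝ 2 f) (x : E) (r : ℝ) :
    ∃ C : ℝ≥0, LipschitzOnWith C (gradient f) (Metric.ball x r) := by
  have h1 : ContDiff ℝ 1 (fderiv ℝ f) := hf.fderiv_right (by norm_num)
  obtain ⟨C, hC⟩ := (h1.locallyLipschitz.locallyLipschitzOn
    (s := Metric.closedBall x r)).exists_lipschitzOnWith_of_compact (isCompact_closedBall x r)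
  refine ⟨C, LipschitzOnWith.of_dist_le_mul fun y hy z hz => ?_⟩
  rw [dist_eq_norm, norm_gradient_sub_gradient, ← dist_eq_norm]
  exact hC.dist_le_mul y (Metric.ball_subset_closedBall hy) z (Metric.ball_subset_closedBall hz)

theorem exists_abs_taylor_le_of_contDiff [ProperSpace E] {f : E → ℝ}
    (hf : ContDiff ℝ 2 f) (x : E) :
    ∃ C : ℝ, 0 ≤ C ∧ ∀ y : E, ‖y‖ < 1 →
      |f (x + y) - f x - inner ℝ y (gradient f x)| ≤ C * ‖y‖ ^ 2 := by
  obtain ⟨C, hC⟩ := hf.exists_lipschitzOnWith_gradient x 1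
  refine ⟨C, C.2, fun y hy => ?_⟩
  have hsub : Metric.closedBall x ‖y‖ ⊆ Metric.ball x 1 := Metric.closedBall_subset_ball hy
  have hd : Differentiable ℝ f := hf.differentiable (by norm_num)
  have h := (convex_closedBall x ‖y‖).norm_image_sub_le_of_norm_hasFDerivWithin_le'
    (f := f) (f' := fderiv ℝ f) (φ := fderiv ℝ f x) (C := C * ‖y‖) (x := x) (y := x + y)
    (fun z _ => (hd z).hasFDerivAt.hasFDerivWithinAt)
    (fun z hz => by
      rw [← norm_gradient_sub_gradient, ← dist_eq_norm]
      refine (hC.dist_le_mul z (hsub hz) x (Metric.mem_ball_self one_pos)).trans ?_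
      gcongr
      exact hz) (by simp) (by simp)
  rw [add_sub_cancel_left, ← inner_gradient_left, real_inner_comm, Real.norm_eq_abs] at h
  rwa [pow_two, ← mul_assoc]
end Taylor

/-! ### Bounds for `L_K` from below. -/

section
variable {d : ℕ} {s lam Lam ρ : ℝ} {K : EuclideanSpace ℝ (Fin d) → ℝ}

/-- For smooth bounded functions, `q` is the order to which `diffOp` is controlled near `y = 0` and
`q'` its growth at infinity. At `s = 1/2` the cutoff of the gradient term gives `q = 2` and `q' =
0`. -/
theorem exists_moment_orders (hs₀ : 0 < s) (hs₁ : s < 1) :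
    ∃ q q' : ℕ, 2 * s < q ∧ (q' : ℝ) < 2 * s ∧
      q = (if s < 1 / 2 then 1 else 2) ∧ q' = (if s ≤ 1 / 2 then 0 else 1) := by
  refine ⟨_, _, ?_, ?_, rfl, rfl⟩ <;> split_ifs <;> push_cast <;> linarith

theorem measurable_diffOp {w : EuclideanSpace ℝ (Fin d) → ℝ} (hw : Measurable w)
    (x : EuclideanSpace ℝ (Fin d)) : Measurable (diffOp s w x) := by
  have h1 : Measurable fun y => w (x + y) - w x := by fun_prop
  have h2 : Measurable fun y : EuclideanSpace ℝ (Fin d) => (inner ℝ y (gradient w x) : ℝ) := by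
    fun_prop
  unfold diffOp
  split_ifs
  · exact h1
  · exact h1.sub (h2.indicator measurableSet_ball)
  · exact h1.sub h2

/-- A bounded function that is `C²` makes sense in `levyOp`. -/
theorem integrable_diffOp_mul (hd : 1 ≤ d) (hs₀ : 0 < s) (hs₁ : s < 1) (hLam : 0 < Lam)
    (hK : IsAdmissibleKernel d s lam Lam ρ K) {w : EuclideanSpace ℝ (Fin d) → ℝ}
    (hw : ContDiff ℝ 2 w) {M : ℝ} (hM : ∀ x, |w x| ≤ M) (x : EuclideanSpace ℝ (Fin d)) :
    Integrable (fun y => diffOp s w x y * K y) := by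
  obtain ⟨q, q', hq, hq', hqe, hqe'⟩ := exists_moment_orders hs₀ hs₁
  obtain ⟨C, hC, hT⟩ := exists_abs_taylor_le_of_contDiff hw x
  obtain ⟨C₁, -, h₁⟩ := exists_moment_ball_le hd lam ρ hLam hq
  obtain ⟨C₂, -, h₂⟩ := exists_moment_compl_ball_le (d := d) lam ρ hLam hq'
  have i₁ := (h₁ K hK 1 one_pos).1
  have i₂ := (h₂ K hK 1 one_pos).1
  set g := gradient w x with hg
  have hinner : ∀ y : EuclideanSpace ℝ (Fin d), |inner ℝ y g| ≤ ‖y‖ * ‖g‖ :=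
    fun y => abs_real_inner_le_norm y g
  have hmeas : AEStronglyMeasurable (fun y => diffOp s w x y * K y) :=
    (measurable_diffOp hw.continuous.measurable x).aestronglyMeasurable.mul
      (hK.aestronglyMeasurable hd)
  have hbdd : ∀ y, |w (x + y) - w x| ≤ 2 * M := fun y => by
    have := abs_sub (w (x + y)) (w x)
    linarith [hM x, hM (x + y)]
  have near : ∀ y ∈ Metric.ball (0 : EuclideanSpace ℝ (Fin d)) 1,
      |diffOp s w x y| ≤ (C + ‖g‖) * ‖y‖ ^ q := by
    intro y hy
    have hy1 := mem_ball_zero_iff.1 hy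
    have h0 := norm_nonneg y
    have hg0 := norm_nonneg g
    have ht := hT y hy1
    have hi := hinner y
    unfold diffOp
    by_cases h : s < 1 / 2
    · rw [if_pos h, hqe, if_pos h, pow_one]
      have hsq : C * ‖y‖ ^ 2 ≤ C * ‖y‖ := by
        gcongr
        nlinarith
      have := abs_add_le (w (x + y) - w x - inner ℝ y g) (inner ℝ y g)
      rw [sub_add_cancel] at this
      nlinarith
    · have hle : C * ‖y‖ ^ 2 ≤ (C + ‖g‖) * ‖y‖ ^ 2 := by gcongr; linarith
      rw [if_neg h, hqe, if_neg h]
      split_ifs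
      · rw [indicator_of_mem hy]
        exact ht.trans hle
      · exact ht.trans hle
  have far : ∀ y ∈ (Metric.ball (0 : EuclideanSpace ℝ (Fin d)) 1)ᶜ,
      |diffOp s w x y| ≤ (2 * M + ‖g‖) * ‖y‖ ^ q' := by
    intro y hy
    have hy1 : 1 ≤ ‖y‖ := by simpa using hy
    have hb := hbdd y
    have hg0 := norm_nonneg g
    have hM0 : 0 ≤ M := (abs_nonneg _).trans (hM x)
    unfold diffOp
    split_ifs with h1 h2
    · rw [hqe', if_pos h1.le, pow_zero]
      linarith
    · rw [hqe', if_pos h2.le, pow_zero, indicator_of_notMem hy, sub_zero]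
      linarith
    · rw [hqe', if_neg (fun h => h.lt_or_eq.elim h1 h2), pow_one]
      have := abs_sub (w (x + y) - w x) (inner ℝ y g)
      nlinarith [hinner y]
  have e₁ : IntegrableOn (fun y => diffOp s w x y * K y) (Metric.ball 0 1) := by
    refine Integrable.mono' (i₁.const_mul (C + ‖g‖)) hmeas.restrict ?_
    refine (ae_restrict_iff' measurableSet_ball).2 (Filter.Eventually.of_forall fun y hy => ?_)
    rw [Real.norm_eq_abs, abs_mul, abs_of_nonneg (hK.nonneg y), ← mul_assoc]
    exact mul_le_mul_of_nonneg_right (near y hy) (hK.nonneg y)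
  have e₂ : IntegrableOn (fun y => diffOp s w x y * K y) (Metric.ball 0 1)ᶜ := by
    refine Integrable.mono' (i₂.const_mul (2 * M + ‖g‖)) hmeas.restrict ?_
    refine (ae_restrict_iff' measurableSet_ball.compl).2
      (Filter.Eventually.of_forall fun y hy => ?_)
    rw [Real.norm_eq_abs, abs_mul, abs_of_nonneg (hK.nonneg y), ← mul_assoc]
    exact mul_le_mul_of_nonneg_right (far y hy) (hK.nonneg y)
  have := e₁.union e₂
  rwa [union_compl_self, integrableOn_univ] at this

/-- Away from the origin, bounded functions are integrable against admissible kernels. -/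
theorem integrableOn_compl_ball_mul (hd : 1 ≤ d) (hs₀ : 0 < s) (hLam : 0 < Lam)
    (hK : IsAdmissibleKernel d s lam Lam ρ K) {f : EuclideanSpace ℝ (Fin d) → ℝ}
    (hf : Measurable f) {M : ℝ} (hM : ∀ x, |f x| ≤ M) {r : ℝ} (hr : 0 < r) :
    IntegrableOn (fun y => f y * K y) (Metric.ball 0 r)ᶜ := by
  obtain ⟨C₂, -, h₂⟩ := exists_moment_compl_ball_le (d := d) (q := 0) lam ρ hLam
    (by push_cast; linarith : ((0 : ℕ) : ℝ) < 2 * s)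
  have i₂ := (h₂ K hK r hr).1
  simp only [pow_zero, one_mul] at i₂
  refine Integrable.mono' (i₂.const_mul M)
    (hf.aestronglyMeasurable.mul (hK.aestronglyMeasurable hd)).restrict
    (Filter.Eventually.of_forall fun y => ?_)
  rw [Real.norm_eq_abs, abs_mul, abs_of_nonneg (hK.nonneg y)]
  exact mul_le_mul_of_nonneg_right (hM y) (hK.nonneg y)

/-- The lower bound on `L_K f` for a nonnegative function `f` whose increments are controlled
from below by `f` itself, on a dyadic scale `R = 2^k`. -/
theorem exists_levyOp_ge (hd : 1 ≤ d) (hs₀ : 0 < s) (hs₁ : s < 1) (lam ρ : ℝ) (hLam : 0 < Lam) :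
    ∃ C : ℝ, 0 ≤ C ∧ ∀ K : EuclideanSpace ℝ (Fin d) → ℝ, IsAdmissibleKernel d s lam Lam ρ K →
      ∀ (k : ℕ) (R : ℝ), R = 2 ^ k → ∀ (f : EuclideanSpace ℝ (Fin d) → ℝ)
        (x : EuclideanSpace ℝ (Fin d)) (A : ℝ),
      Integrable (fun y => diffOp s f x y * K y) → (∀ y, 0 ≤ f y) → f x ≤ A →
      ‖gradient f x‖ ≤ A / R →
      (∀ y, f x + inner ℝ y (gradient f x) - A * (‖y‖ ^ 2 / R ^ 2) ≤ f (x + y)) →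
      -(C * A * R ^ (-(2 * s))) ≤ levyOp s K f x := by
  obtain ⟨q, q', hq, hq', hqe, hqe'⟩ := exists_moment_orders hs₀ hs₁
  obtain ⟨C₁, hC₁, h₁⟩ := exists_moment_ball_le hd lam ρ hLam hq
  obtain ⟨C₂, hC₂, h₂⟩ := exists_moment_compl_ball_le (d := d) lam ρ hLam hq'
  refine ⟨2 * C₁ + 2 * C₂, by positivity, fun K hK k R hRk f x A hint hf hfA hgA hfy => ?_⟩
  have hR : 0 < R := by rw [hRk]; positivity
  have hA : 0 ≤ A := (hf x).trans hfA
  obtain ⟨i₁, j₁⟩ := h₁ K hK R hR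
  obtain ⟨i₂, j₂⟩ := h₂ K hK R hR
  set g := gradient f x with hg
  have hinner : ∀ y : EuclideanSpace ℝ (Fin d), |inner ℝ y g| ≤ A * (‖y‖ / R) := fun y =>
    (abs_real_inner_le_norm y g).trans (by
      rw [mul_comm, mul_div_assoc', ← div_mul_eq_mul_div]; gcongr)
  -- Far away only `f ≥ 0` and the gradient bound are used. For `s = 1/2` the gradient term is
  -- absent there, since `R = 2 ^ k ≥ 1`.
  have far : ∀ y ∈ (Metric.ball (0 : EuclideanSpace ℝ (Fin d)) R)ᶜ,
      -(2 * A / R ^ q' * (‖y‖ ^ q' * K y)) ≤ diffOp s f x y * K y := by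
    intro y hy
    have hy1 : R ≤ ‖y‖ := by simpa using hy
    have hyR : 1 ≤ ‖y‖ / R := by rwa [one_le_div hR]
    have key : -(2 * A * (‖y‖ / R) ^ q') ≤ diffOp s f x y := by
      have := hf (x + y)
      unfold diffOp
      split_ifs with h1 h2
      · rw [hqe', if_pos h1.le, pow_zero]
        linarith
      · have hy' : y ∉ Metric.ball (0 : EuclideanSpace ℝ (Fin d)) 1 := by
          rw [mem_ball_zero_iff, not_lt]
          refine le_trans ?_ hy1
          rw [hRk]
          exact one_le_pow₀ (by norm_num)
        rw [hqe', if_pos h2.le, pow_zero, indicator_of_notMem hy', sub_zero]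
        linarith
      · rw [hqe', if_neg (fun h => h.lt_or_eq.elim h1 h2), pow_one]
        have := (abs_le.1 (hinner y)).2
        nlinarith
    have := mul_le_mul_of_nonneg_right key (hK.nonneg y)
    refine le_trans (le_of_eq ?_) this
    rw [div_pow]; ring
  -- The correction `c` matters only for `s = 1/2`: it is the gradient term that `diffOp` lacks on
  -- `B_R \ B_1`. It integrates to zero because this ring is a union of dyadic annuli, which is why
  -- `R` is a power of two.
  obtain ⟨c, hci, hc0, near⟩ : ∃ c : EuclideanSpace ℝ (Fin d) → ℝ,
      IntegrableOn c (Metric.ball 0 R) ∧ ∫ y in Metric.ball 0 R, c y = 0 ∧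
      ∀ y ∈ Metric.ball (0 : EuclideanSpace ℝ (Fin d)) R,
      -(2 * A / R ^ q * (‖y‖ ^ q * K y)) + c y ≤ diffOp s f x y * K y := by
    have quad : ∀ y, -(2 * A * (‖y‖ / R) ^ 2) ≤ f (x + y) - f x - inner ℝ y g := fun y => by
      have := hfy y
      rw [← div_pow] at this
      nlinarith [mul_nonneg hA (sq_nonneg (‖y‖ / R))]
    by_cases h1 : s < 1 / 2
    · refine ⟨0, integrableOn_zero, by simp, fun y hy => ?_⟩
      have hyR : ‖y‖ / R ≤ 1 := by
        rw [div_le_one hR]; exact (mem_ball_zero_iff.1 hy).le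
      have h0 : 0 ≤ ‖y‖ / R := by positivity
      have key : -(2 * A * (‖y‖ / R) ^ q) ≤ diffOp s f x y := by
        unfold diffOp
        rw [if_pos h1, hqe, if_pos h1, pow_one]
        have := hfy y
        rw [← div_pow] at this
        have h3 := (abs_le.1 (hinner y)).1
        have h4 : A * (‖y‖ / R) ^ 2 ≤ A * (‖y‖ / R) := by gcongr; nlinarith
        linarith
      have := mul_le_mul_of_nonneg_right key (hK.nonneg y)
      refine le_trans (le_of_eq ?_) this
      rw [div_pow, Pi.zero_apply]; ring
    · by_cases h2 : s = 1 / 2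
      · obtain ⟨a1, a2⟩ := hK.integral_smul_ring_eq_zero h2 k
        rw [← hRk] at a1 a2
        have hm : MeasurableSet (Metric.ball (0 : EuclideanSpace ℝ (Fin d)) 1)ᶜ :=
          measurableSet_ball.compl
        refine ⟨(Metric.ball 0 1)ᶜ.indicator fun y => inner ℝ g (K y • y), ?_, ?_, ?_⟩
        · rw [IntegrableOn, integrable_indicator_iff hm, IntegrableOn,
            Measure.restrict_restrict hm, inter_comm, ← sdiff_eq]
          exact a1.const_inner g
        · rw [setIntegral_indicator hm, ← sdiff_eq, integral_inner a1, a2, inner_zero_right]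
        · intro y hy
          have hq2 := quad y
          have := mul_le_mul_of_nonneg_right hq2 (hK.nonneg y)
          have hd' : diffOp s f x y * K y = (f (x + y) - f x - inner ℝ y g) * K y
              + (Metric.ball 0 1)ᶜ.indicator (fun y => inner ℝ g (K y • y)) y := by
            unfold diffOp
            rw [if_neg h1, if_pos h2]
            by_cases hy1 : y ∈ Metric.ball (0 : EuclideanSpace ℝ (Fin d)) 1
            · rw [indicator_of_mem hy1, indicator_of_notMem (by simpa using hy1), add_zero]
            · rw [indicator_of_notMem hy1, indicator_of_mem (by simpa using hy1),
                inner_smul_right, real_inner_comm]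
              ring
          rw [hd', add_le_add_iff_right]
          refine le_trans (le_of_eq ?_) this
          rw [div_pow, hqe, if_neg h1]; ring
      · refine ⟨0, integrableOn_zero, by simp, fun y hy => ?_⟩
        have := mul_le_mul_of_nonneg_right (quad y) (hK.nonneg y)
        unfold diffOp
        rw [if_neg h1, if_neg h2, hqe, if_neg h1]
        refine le_trans (le_of_eq ?_) this
        rw [div_pow, Pi.zero_apply]; ring
  have n₁ : IntegrableOn (fun y => -(2 * A / R ^ q * (‖y‖ ^ q * K y))) (Metric.ball 0 R) :=
    (i₁.const_mul (2 * A / R ^ q)).neg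
  have n₂ : IntegrableOn (fun y => -(2 * A / R ^ q' * (‖y‖ ^ q' * K y))) (Metric.ball 0 R)ᶜ :=
    (i₂.const_mul (2 * A / R ^ q')).neg
  have e₁ := setIntegral_mono_on (n₁.add hci) hint.integrableOn
    measurableSet_ball near
  have e₂ := setIntegral_mono_on n₂ hint.integrableOn
    measurableSet_ball.compl far
  rw [integral_add' n₁ hci, hc0, add_zero, integral_neg,
    integral_const_mul] at e₁
  rw [integral_neg, integral_const_mul] at e₂
  unfold levyOp
  rw [← integral_add_compl measurableSet_ball hint]
  have hpow : ∀ n : ℕ, ∀ C : ℝ, 2 * A / R ^ n * (C * R ^ ((n : ℝ) - 2 * s))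
      = 2 * C * A * R ^ (-(2 * s)) := fun n C => by
    rw [sub_eq_add_neg, Real.rpow_add hR, Real.rpow_natCast]
    field_simp
  have b₁ : 2 * A / R ^ q * ∫ y in Metric.ball 0 R, ‖y‖ ^ q * K y
      ≤ 2 * C₁ * A * R ^ (-(2 * s)) := by
    rw [← hpow q]; gcongr
  have b₂ : 2 * A / R ^ q' * ∫ y in (Metric.ball 0 R)ᶜ, ‖y‖ ^ q' * K y
      ≤ 2 * C₂ * A * R ^ (-(2 * s)) := by
    rw [← hpow q']; gcongr
  linarith [add_mul (2 * C₁ * A) (2 * C₂ * A) (R ^ (-(2 * s))),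
    (by ring : (2 * C₁ + 2 * C₂) * A * R ^ (-(2 * s)) =
      2 * C₁ * A * R ^ (-(2 * s)) + 2 * C₂ * A * R ^ (-(2 * s)))]

/-- On each ball of radius `R ≥ ρ`, admissible kernels centred at `x` are bounded below by a
multiple of `bump d R x`. -/
theorem IsAdmissibleKernel.bump_le (hK : IsAdmissibleKernel d s lam Lam ρ K) (hs₀ : 0 < s)
    (hs₁ : s < 1) (hlam : 0 < lam) (hρ : 0 ≤ ρ) {R : ℝ} (hR : 0 < R) (hρR : ρ ≤ R)
    {x z : EuclideanSpace ℝ (Fin d)} (hz : ‖z‖ < R) (hzx : z ≠ x) :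
    lam * (2 ^ (d + 1))⁻¹ * R ^ (-(d : ℝ) - 2 * s) * bump d R x ≤ K (z - x) := by
  have hzx' : z - x ≠ 0 := sub_ne_zero.2 hzx
  have hexp : -(d : ℝ) - 2 * s ≤ 0 := by have := Nat.cast_nonneg (α := ℝ) d; linarith
  refine le_trans ?_ (hK.lower _ hzx')
  rw [mul_assoc, mul_assoc]
  refine mul_le_mul_of_nonneg_left ?_ hlam.le
  -- `S` dominates both `|z - x|` and `ρ`, so both terms of the minimum are at least `S^(-d-2s)`.
  set S := R + ‖x‖ with hS
  have hS0 : 0 < S := by positivity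
  have hpos : 0 < ‖z - x‖ := norm_pos_iff.2 hzx'
  have hle : ‖z - x‖ ≤ S := (norm_sub_le z x).trans (by linarith)
  have h1 : S ^ (-(d : ℝ) - 2 * s) ≤ lowerKernel d s ρ (z - x) := by
    unfold lowerKernel
    split_ifs with h
    · exact Real.rpow_le_rpow_of_nonpos hpos hle hexp
    · refine le_min (Real.rpow_le_rpow_of_nonpos hpos hle hexp)
        (Real.rpow_le_rpow_of_nonpos (lt_of_le_of_ne hρ (Ne.symm h)) ?_ hexp)
      have := norm_nonneg x
      linarith
  refine le_trans ?_ h1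
  have hSR : S = R * (1 + ‖x‖ / R) := by rw [hS]; field_simp
  have ht0 : 0 ≤ ‖x‖ / R := by positivity
  rw [hSR, Real.mul_rpow hR.le (by positivity), mul_left_comm]
  refine mul_le_mul_of_nonneg_left ?_ (by positivity)
  have hb : bump d R x = ((1 + (‖x‖ / R) ^ 2) ^ (d + 1))⁻¹ := by unfold bump; rw [div_pow]
  rw [hb, ← mul_inv, ← mul_pow]
  set t := ‖x‖ / R
  -- This costs the factor `2^(-(d+1))` and bounds the barrier by `(1 + t)^(-2(d+1))`, which is
  -- below `(1 + t)^(-d-2s)` since `s < 1`.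
  have h2 : (1 + t) ^ 2 ≤ 2 * (1 + t ^ 2) := by nlinarith [sq_nonneg (1 - t)]
  calc ((2 * (1 + t ^ 2)) ^ (d + 1))⁻¹ ≤ (((1 + t) ^ 2) ^ (d + 1))⁻¹ := by gcongr
    _ = (1 + t) ^ (-(2 * ((d : ℝ) + 1))) := by
        rw [Real.rpow_neg (by positivity), ← pow_mul, ← Real.rpow_natCast]
        push_cast; rfl
    _ ≤ (1 + t) ^ (-(d : ℝ) - 2 * s) := by
        apply Real.rpow_le_rpow_of_exponent_le (by linarith)
        have := Nat.cast_nonneg (α := ℝ) d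
        linarith

end

/-! ### From viscosity inequalities to an inequality at touching points. -/

section
variable {d : ℕ} {s lam Lam ρ : ℝ} {K : EuclideanSpace ℝ (Fin d) → ℝ}

theorem volume_real_ball (hd : 1 ≤ d) (x : EuclideanSpace ℝ (Fin d)) {r : ℝ} (hr : 0 ≤ r) :
    volume.real (Metric.ball x r)
      = r ^ d * volume.real (Metric.ball (0 : EuclideanSpace ℝ (Fin d)) 1) := by
  have : Nonempty (Fin d) := ⟨⟨0, hd⟩⟩
  simp only [measureReal_def]
  rw [Measure.addHaar_ball volume x hr, finrank_euclideanSpace_fin, ENNReal.toReal_mul,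
    ENNReal.toReal_ofReal (by positivity)]

open Classical in
/-- The function that equals `f` in `B_ε(x₀)` and `w` elsewhere. -/
def patch (f w : EuclideanSpace ℝ (Fin d) → ℝ) (x₀ : EuclideanSpace ℝ (Fin d)) (ε : ℝ)
    (x : EuclideanSpace ℝ (Fin d)) : ℝ :=
  if x ∈ Metric.ball x₀ ε then f x else w x

/-- Whenever a test function touches `u` from above, its time derivative is at most `L_K` of the
patched function, up to an arbitrarily small error, for some admissible kernel. -/
def IsSubsolutionUpToError (s lam Lam ρ : ℝ) (u : EuclideanSpace ℝ (Fin d) → ℝ → ℝ) : Prop :=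
  ∀ x₀ : EuclideanSpace ℝ (Fin d), ∀ t₀ ≤ 0, ∀ ε > 0, ∀ φ : EuclideanSpace ℝ (Fin d) → ℝ → ℝ,
    IsTestFunction φ x₀ t₀ ε → u x₀ t₀ = φ x₀ t₀ →
    (∀ x ∈ Metric.ball x₀ ε, ∀ t ∈ Ioc (t₀ - ε) t₀, u x t ≤ φ x t) →
    ∀ e > 0, ∃ K : EuclideanSpace ℝ (Fin d) → ℝ, IsAdmissibleKernel d s lam Lam ρ K ∧
      derivWithin (fun τ => φ x₀ τ) (Iic t₀) t₀ - e
        < levyOp s K (patch (fun x => φ x t₀) (fun x => u x t₀) x₀ ε) x₀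

theorem IsSubsolutionUpToError.congr {u v : EuclideanSpace ℝ (Fin d) → ℝ → ℝ}
    (hu : IsSubsolutionUpToError s lam Lam ρ u) (h : ∀ x, ∀ t ≤ 0, u x t = v x t) :
    IsSubsolutionUpToError s lam Lam ρ v := by
  intro x₀ t₀ ht₀ ε hε φ hφ heq hle e he
  obtain ⟨K, hK, hlt⟩ := hu x₀ t₀ ht₀ ε hε φ hφ ((h _ _ ht₀).trans heq)
    (fun x hx t ht => (h x t (ht.2.trans ht₀)).trans_le (hle x hx t ht)) e he
  refine ⟨K, hK, ?_⟩
  have : (fun x => u x t₀) = fun x => v x t₀ := funext fun x => h x t₀ ht₀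
  rwa [this] at hlt

theorem glue_eq_patch (u φ : EuclideanSpace ℝ (Fin d) → ℝ → ℝ) (x₀ : EuclideanSpace ℝ (Fin d))
    (t₀ : ℝ) {ε : ℝ} (hε : 0 < ε) :
    (fun x => glue u φ x₀ t₀ ε x t₀) = patch (fun x => φ x t₀) (fun x => u x t₀) x₀ ε := by
  funext x
  have : t₀ ∈ Ioc (t₀ - ε) t₀ := ⟨by linarith, le_rfl⟩
  simp [glue, patch, hε]

theorem leftTimeDeriv_glue (u φ : EuclideanSpace ℝ (Fin d) → ℝ → ℝ)
    (x₀ : EuclideanSpace ℝ (Fin d)) (t₀ : ℝ) {ε : ℝ} (hε : 0 < ε) :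
    leftTimeDeriv (glue u φ x₀ t₀ ε) x₀ t₀ = derivWithin (fun τ => φ x₀ τ) (Iic t₀) t₀ := by
  have hx : x₀ ∈ Metric.ball x₀ ε := Metric.mem_ball_self hε
  refine Filter.EventuallyEq.derivWithin_eq ?_ ?_
  · filter_upwards [Ioc_mem_nhdsLE (by linarith : t₀ - ε < t₀)] with t ht
    exact if_pos ⟨hx, ht⟩
  · exact if_pos ⟨hx, by linarith, le_rfl⟩

/-- The supremum over kernels need not be attained, hence the error `e`. If every kernel failed, the
supremum would be at most `D - e` and the viscosity inequality would give `e ≤ 0`. -/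
theorem IsViscositySubsolution.isSubsolutionUpToError
    {u : EuclideanSpace ℝ (Fin d) → ℝ → ℝ}
    (h : IsViscositySubsolution (pucciSup s lam Lam ρ) (fun _ _ => 0) univ (Iic 0) u) :
    IsSubsolutionUpToError s lam Lam ρ u := by
  intro x₀ t₀ ht₀ ε hε φ hφ heq hle e he
  have h1 := h.le_of_touching x₀ (mem_univ _) t₀ ht₀ ε hε
    (prod_mono (subset_univ _) fun t ht => ht.2.trans ht₀) φ hφ heq hle
  simp only [glue_eq_patch u φ x₀ t₀ hε, leftTimeDeriv_glue u φ x₀ t₀ hε] at h1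
  by_contra! hcon
  set D := derivWithin (fun τ => φ x₀ τ) (Iic t₀) t₀
  have h2 : pucciSup s lam Lam ρ (patch (fun x => φ x t₀) (fun x => u x t₀) x₀ ε) x₀
      ≤ ((D - e : ℝ) : EReal) :=
    iSup₂_le fun K hK => EReal.coe_le_coe_iff.2 (hcon K hK)
  have h3 := (EReal.sub_le_sub (le_refl (D : EReal)) h2).trans h1
  rw [← EReal.coe_sub, EReal.coe_le_coe_iff] at h3
  linarith

theorem IsTestFunction.neg {φ : EuclideanSpace ℝ (Fin d) → ℝ → ℝ}
    {x₀ : EuclideanSpace ℝ (Fin d)} {t₀ ε : ℝ} (h : IsTestFunction φ x₀ t₀ ε) :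
    IsTestFunction (fun x t => -φ x t) x₀ t₀ ε where
  left_differentiable x hx t ht := (h.left_differentiable x hx t ht).neg
  differentiable t ht := (h.differentiable t ht).neg
  lipschitz_gradient t ht := by
    obtain ⟨C, hC⟩ := h.lipschitz_gradient t ht
    refine ⟨C, LipschitzOnWith.of_dist_le_mul fun y hy z hz => ?_⟩
    have := hC.dist_le_mul y hy z hz
    rw [dist_eq_norm, norm_gradient_sub_gradient] at this ⊢
    rwa [fderiv_fun_neg, fderiv_fun_neg, neg_sub_neg, norm_sub_rev]

theorem levyOp_neg (w : EuclideanSpace ℝ (Fin d) → ℝ) (x : EuclideanSpace ℝ (Fin d)) :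
    levyOp s K (fun y => -w y) x = -levyOp s K w x := by
  have hg : gradient (fun y => -w y) x = -gradient w x := by
    unfold gradient
    rw [fderiv_fun_neg, map_neg]
  unfold levyOp
  rw [← integral_neg]
  congr 1
  funext y
  rw [← neg_mul]
  congr 1
  unfold diffOp
  simp only [hg, inner_neg_right]
  split_ifs
  · ring
  · by_cases hy : y ∈ Metric.ball (0 : EuclideanSpace ℝ (Fin d)) 1
    · simp only [indicator_of_mem hy]; ring
    · simp only [indicator_of_notMem hy]; ring
  · ring

/-- `L_K` is odd in `w`, so negation exchanges the two Pucci operators and only subsolutions need to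
be studied. -/
theorem IsViscositySupersolution.isSubsolutionUpToError_neg
    {u : EuclideanSpace ℝ (Fin d) → ℝ → ℝ}
    (h : IsViscositySupersolution (pucciInf s lam Lam ρ) (fun _ _ => 0) univ (Iic 0) u) :
    IsSubsolutionUpToError s lam Lam ρ fun x t => -u x t := by
  intro x₀ t₀ ht₀ ε hε φ hφ heq hle e he
  have h1 := h.ge_of_touching x₀ (mem_univ _) t₀ ht₀ ε hε
    (prod_mono (subset_univ _) fun t ht => ht.2.trans ht₀) _ hφ.neg (by simp [← heq])
    (fun x hx t ht => by linarith [hle x hx t ht])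
  simp only [glue_eq_patch u _ x₀ t₀ hε, leftTimeDeriv_glue u _ x₀ t₀ hε] at h1
  have hpatch : patch (fun x => -φ x t₀) (fun x => u x t₀) x₀ ε
      = fun x => -patch (fun x => φ x t₀) (fun x => -u x t₀) x₀ ε x := by
    funext x
    unfold patch
    split_ifs <;> simp
  rw [hpatch, derivWithin.fun_neg] at h1
  by_contra! hcon
  set D := derivWithin (fun τ => φ x₀ τ) (Iic t₀) t₀
  have h2 : ((-(D - e) : ℝ) : EReal) ≤ pucciInf s lam Lam ρ
      (fun x => -patch (fun x => φ x t₀) (fun x => -u x t₀) x₀ ε x) x₀ :=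
    le_iInf₂ fun K hK => EReal.coe_le_coe_iff.2 (by
      rw [levyOp_neg]; linarith [hcon K hK])
  have h3 := h1.trans (EReal.sub_le_sub (le_refl ((-D : ℝ) : EReal)) h2)
  rw [← EReal.coe_sub, EReal.coe_le_coe_iff] at h3
  linarith

/-- The increments of a patched barrier. -/
theorem diffOp_patch {η w : EuclideanSpace ℝ (Fin d) → ℝ} (hη : Differentiable ℝ η) (b m : ℝ)
    (x₀ y : EuclideanSpace ℝ (Fin d)) {ε : ℝ} (hε : 0 < ε) :
    diffOp s (patch (fun x => b - m * η x) w x₀ ε) x₀ y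
      = -(m * diffOp s η x₀ y)
        - (Metric.ball 0 ε)ᶜ.indicator (fun y => b - m * η (x₀ + y) - w (x₀ + y)) y := by
  have hx₀ : patch (fun x => b - m * η x) w x₀ ε x₀ = b - m * η x₀ :=
    if_pos (Metric.mem_ball_self hε)
  have hg : gradient (patch (fun x => b - m * η x) w x₀ ε) x₀ = -(m • gradient η x₀) := by
    have he : patch (fun x => b - m * η x) w x₀ ε =ᶠ[nhds x₀] fun x => b - m * η x := by
      filter_upwards [Metric.ball_mem_nhds x₀ hε] with x hx
      exact if_pos hx
    rw [he.gradient_eq]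
    unfold gradient
    rw [fderiv_const_sub, fderiv_const_mul (hη x₀), map_neg, map_smul]
  have hy : patch (fun x => b - m * η x) w x₀ ε (x₀ + y) = b - m * η (x₀ + y)
      - (Metric.ball 0 ε)ᶜ.indicator (fun y => b - m * η (x₀ + y) - w (x₀ + y)) y := by
    by_cases h : y ∈ Metric.ball (0 : EuclideanSpace ℝ (Fin d)) ε
    · rw [indicator_of_notMem (by simpa using h), sub_zero]
      exact if_pos (by simpa [Metric.mem_ball, dist_eq_norm] using h)
    · rw [indicator_of_mem h]
      refine (if_neg (by simpa [Metric.mem_ball, dist_eq_norm] using h)).trans ?_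
      ring
  unfold diffOp
  rw [hx₀, hy, hg]
  simp only [inner_neg_right, inner_smul_right]
  split_ifs
  · ring
  · by_cases h : y ∈ Metric.ball (0 : EuclideanSpace ℝ (Fin d)) 1
    · simp only [indicator_of_mem h]; ring
    · simp only [indicator_of_notMem h]; ring
  · ring

theorem isTestFunction_sub_mul {η : EuclideanSpace ℝ (Fin d) → ℝ} (hη : ContDiff ℝ 2 η)
    {b m : ℝ → ℝ} (hb : Differentiable ℝ b) (hm : Differentiable ℝ m)
    (x₀ : EuclideanSpace ℝ (Fin d)) (t₀ ε : ℝ) :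
    IsTestFunction (fun x t => b t - m t * η x) x₀ t₀ ε where
  left_differentiable x _ t _ :=
    ((hb t).sub ((hm t).mul_const _)).differentiableWithinAt
  differentiable t _ :=
    (((hη.differentiable (by norm_num)).const_mul _).const_sub _).differentiableOn
  lipschitz_gradient t _ :=
    (contDiff_const.sub (contDiff_const.mul hη)).exists_lipschitzOnWith_gradient x₀ ε

/-- The differential inequality at a point where `b(t) - m(t) η(x)` touches `u` from above. -/
theorem exists_touching_inequality (hd : 1 ≤ d) (hs₀ : 0 < s) (hs₁ : s < 1) (hlam : 0 < lam)
    (hLam : 0 < Lam) (hρ : 0 ≤ ρ) :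
    ∃ C : ℝ, 0 ≤ C ∧ ∀ u : EuclideanSpace ℝ (Fin d) → ℝ → ℝ,
      IsSubsolutionUpToError s lam Lam ρ u → (∀ t ≤ 0, Continuous fun x => u x t) →
      ∀ B : ℝ, (∀ x, ∀ t ≤ 0, |u x t| ≤ B) → ∀ (k : ℕ) (R : ℝ), R = 2 ^ k → ρ ≤ R →
      ∀ b m : ℝ → ℝ, Differentiable ℝ b → Differentiable ℝ m →
      ∀ (x₀ : EuclideanSpace ℝ (Fin d)) (t₁ t₀ : ℝ), t₀ ≤ 0 → t₁ < t₀ → 0 ≤ m t₀ →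
      u x₀ t₀ = b t₀ - m t₀ * bump d R x₀ →
      (∀ x, ∀ t ∈ Icc t₁ t₀, u x t ≤ b t - m t * bump d R x) →
      deriv b t₀ - deriv m t₀ * bump d R x₀ ≤ C * m t₀ * bump d R x₀ * R ^ (-(2 * s))
        - lam * (2 ^ (d + 1))⁻¹ * R ^ (-(d : ℝ) - 2 * s) * bump d R x₀ *
          ∫ x in Metric.ball 0 R, (b t₀ - m t₀ * bump d R x - u x t₀) := by
  obtain ⟨C, hC0, hC⟩ := exists_levyOp_ge hd hs₀ hs₁ lam ρ hLam
  refine ⟨C * (d + 1), by positivity, ?_⟩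
  intro u hu hcont B hB k R hRk hρR b m hb hm x₀ t₁ t₀ ht₀ ht₁ hm0 heq hle
  have hR : 0 < R := by rw [hRk]; positivity
  set η := bump d R with hη
  have hη2 : ContDiff ℝ 2 η := contDiff_bump
  have hηd : Differentiable ℝ η := hη2.differentiable (by norm_num)
  have hηabs : ∀ x, |η x| ≤ 1 := fun x => by
    rw [abs_of_nonneg (bump_pos x).le]; exact bump_le_one x
  set h : EuclideanSpace ℝ (Fin d) → ℝ := fun x => b t₀ - m t₀ * η x - u x t₀ with hh
  have hhc : Continuous h := by
    have := hcont t₀ ht₀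
    have := hηd.continuous
    fun_prop
  have hh0 : ∀ x, 0 ≤ h x := fun x => sub_nonneg.2 (hle x t₀ ⟨ht₁.le, le_rfl⟩)
  set D := |b t₀| + m t₀ + B with hD
  have hhD : ∀ x, h x ≤ D := fun x => by
    have h1 := neg_le_of_abs_le (hB x t₀ ht₀)
    have h2 := le_abs_self (b t₀)
    have h3 := mul_nonneg hm0 (bump_pos (R := R) x).le
    simp only [hh, hD]
    linarith
  have hD0 : 0 ≤ D := (hh0 0).trans (hhD 0)
  set Q := lam * (2 ^ (d + 1))⁻¹ * R ^ (-(d : ℝ) - 2 * s) * η x₀ with hQ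
  have hQ0 : 0 < Q := by have := bump_pos (R := R) x₀; positivity
  set V := volume.real (Metric.ball (0 : EuclideanSpace ℝ (Fin d)) 1) with hV
  have hV0 : 0 ≤ V := measureReal_nonneg
  refine le_of_forall_pos_le_add fun e he => ?_
  -- Patching erases the gap `h` on `B_ε(x₀)`, which costs at most `Q D V ε^d ≤ Q D V ε`. Half of
  -- `e` pays for this and the other half for the choice of the kernel; `ε ≤ t₀ - t₁` keeps the
  -- cylinder within the times where the barrier lies above `u`.
  obtain ⟨ε, hε, hε1, hεt, hεe⟩ : ∃ ε : ℝ, 0 < ε ∧ ε ≤ 1 ∧ ε ≤ t₀ - t₁ ∧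
      Q * D * V * ε ≤ e / 2 := by
    have hden : 0 < Q * D * V + 1 := by positivity
    refine ⟨min 1 (min (t₀ - t₁) (e / 2 / (Q * D * V + 1))), ?_, min_le_left _ _,
      (min_le_right _ _).trans (min_le_left _ _), ?_⟩
    · have := sub_pos.2 ht₁
      positivity
    · have h1 : min 1 (min (t₀ - t₁) (e / 2 / (Q * D * V + 1))) ≤ e / 2 / (Q * D * V + 1) :=
        (min_le_right _ _).trans (min_le_right _ _)
      calc _ ≤ Q * D * V * (e / 2 / (Q * D * V + 1)) := by gcongr
        _ ≤ e / 2 := by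
          rw [mul_div_assoc', div_le_iff₀ hden]; nlinarith
  obtain ⟨K, hK, hlt⟩ := hu x₀ t₀ ht₀ ε hε (fun x t => b t - m t * η x)
    (isTestFunction_sub_mul hη2 hb hm x₀ t₀ ε) heq
    (fun x _ t ht => hle x t ⟨by linarith [ht.1], ht.2⟩) (e / 2) (half_pos he)
  have hderiv : derivWithin (fun τ => b τ - m τ * η x₀) (Iic t₀) t₀
      = deriv b t₀ - deriv m t₀ * η x₀ :=
    (((hb t₀).hasDerivAt.sub ((hm t₀).hasDerivAt.mul_const _)).hasDerivWithinAt).derivWithin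
      (uniqueDiffOn_Iic t₀ t₀ self_mem_Iic)
  rw [hderiv] at hlt
  have iη := integrable_diffOp_mul hd hs₀ hs₁ hLam hK hη2 hηabs x₀
  have hη_lower := hC K hK k R hRk η x₀ ((d + 1) * η x₀) iη (fun y => (bump_pos y).le)
    (by nlinarith [bump_pos (R := R) x₀, Nat.cast_nonneg (α := ℝ) d])
    (norm_gradient_bump_le hR x₀) (bump_add_ge hR x₀)
  have ih : Integrable (fun y => (Metric.ball 0 ε)ᶜ.indicator (fun y => h (x₀ + y)) y * K y) := by
    have := integrableOn_compl_ball_mul hd hs₀ hLam hK (f := fun y => h (x₀ + y))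
      (by fun_prop) (M := D) (fun x => by rw [abs_of_nonneg (hh0 _)]; exact hhD _) hε
    rw [← integrable_indicator_iff measurableSet_ball.compl] at this
    refine this.congr (Filter.Eventually.of_forall fun y => ?_)
    exact (indicator_mul_left _ (fun y => h (x₀ + y)) K)
  -- The patched function is the barrier minus the gap `h` outside `B_ε(x₀)`; the constant `b t₀`
  -- drops out.
  have hlevy : levyOp s K (patch (fun x => b t₀ - m t₀ * η x) (fun x => u x t₀) x₀ ε) x₀
      = -(m t₀ * levyOp s K η x₀)
        - ∫ y, (Metric.ball 0 ε)ᶜ.indicator (fun y => h (x₀ + y)) y * K y := by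
    have i₁ : Integrable (fun y => -(m t₀ * (diffOp s η x₀ y * K y))) := (iη.const_mul _).neg
    unfold levyOp
    rw [← integral_const_mul, ← integral_neg, ← integral_sub i₁ ih]
    congr 1
    funext y
    rw [diffOp_patch hηd _ _ _ _ hε]
    simp only [hh]
    ring
  rw [hlevy] at hlt
  have hball : IntegrableOn h (Metric.ball 0 R) :=
    (hhc.continuousOn.integrableOn_compact (isCompact_closedBall 0 R)).mono_set
      Metric.ball_subset_closedBall
  set F : EuclideanSpace ℝ (Fin d) → ℝ :=
    (Metric.ball 0 R \ Metric.ball x₀ ε).indicator h with hF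
  have hmF : MeasurableSet (Metric.ball (0 : EuclideanSpace ℝ (Fin d)) R \ Metric.ball x₀ ε) :=
    measurableSet_ball.diff measurableSet_ball
  have iF : Integrable F := (integrable_indicator_iff hmF).2 (hball.mono_set sdiff_subset)
  have hnonloc : Q * ∫ x, F x
      ≤ ∫ y, (Metric.ball 0 ε)ᶜ.indicator (fun y => h (x₀ + y)) y * K y := by
    rw [← integral_add_left_eq_self F x₀, ← integral_const_mul]
    refine integral_mono ((iF.comp_add_left x₀).const_mul Q) ih fun y => ?_
    by_cases hy : x₀ + y ∈ Metric.ball (0 : EuclideanSpace ℝ (Fin d)) R \ Metric.ball x₀ ε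
    · have hy2 : y ∈ (Metric.ball (0 : EuclideanSpace ℝ (Fin d)) ε)ᶜ := by
        simpa [Metric.mem_ball, dist_eq_norm] using hy.2
      simp only [hF, indicator_of_mem hy, indicator_of_mem hy2]
      rw [mul_comm Q]
      refine mul_le_mul_of_nonneg_left ?_ (hh0 _)
      have := hK.bump_le hs₀ hs₁ hlam hρ hR hρR (x := x₀) (z := x₀ + y)
        (mem_ball_zero_iff.1 hy.1) (fun h0 => hy.2 (by rw [h0]; exact Metric.mem_ball_self hε))
      rwa [add_sub_cancel_left] at this
    · simp only [hF, indicator_of_notMem hy, mul_zero]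
      exact mul_nonneg (indicator_nonneg (fun y _ => hh0 _) y) (hK.nonneg y)
  have hFint : (∫ x in Metric.ball 0 R, h x) - D * V * ε ≤ ∫ x, F x := by
    have h1 : ∫ x in Metric.ball 0 R ∩ Metric.ball x₀ ε, h x ≤ D * V * ε := by
      have hfin : volume (Metric.ball x₀ ε) < ∞ := measure_ball_lt_top
      calc ∫ x in Metric.ball 0 R ∩ Metric.ball x₀ ε, h x
          ≤ ∫ _ in Metric.ball (0 : EuclideanSpace ℝ (Fin d)) R ∩ Metric.ball x₀ ε, D :=
            setIntegral_mono (hball.mono_set inter_subset_left)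
              (integrableOn_const ((measure_mono inter_subset_right).trans_lt hfin).ne) hhD
        _ = volume.real (Metric.ball (0 : EuclideanSpace ℝ (Fin d)) R ∩ Metric.ball x₀ ε) * D := by
            rw [setIntegral_const, smul_eq_mul]
        _ ≤ volume.real (Metric.ball x₀ ε) * D := by
            gcongr
            · exact hfin.ne
            · exact inter_subset_right
        _ = ε ^ d * V * D := by
            rw [volume_real_ball hd x₀ hε.le]
        _ ≤ ε * V * D := by
            gcongr
            exact pow_le_of_le_one hε.le hε1 (by omega)
        _ = D * V * ε := by ring
    rw [hF, integral_indicator hmF, ← integral_inter_add_sdiff measurableSet_ball hball]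
    linarith
  have h1 := mul_le_mul_of_nonneg_left hη_lower hm0
  have h2 := mul_le_mul_of_nonneg_left hFint hQ0.le
  have h3 : Q * (D * V * ε) ≤ e / 2 := by rw [← mul_assoc, ← mul_assoc]; exact hεe
  have h4 : m t₀ * -(C * ((d + 1) * η x₀) * R ^ (-(2 * s)))
      = -(C * (d + 1) * m t₀ * η x₀ * R ^ (-(2 * s))) := by ring
  linarith [mul_sub Q (∫ x in Metric.ball 0 R, h x) (D * V * ε)]

end

/-! ### Comparison, weak Harnack inequality and the conclusion. -/

section
variable {d : ℕ} {s lam Lam ρ : ℝ} {K : EuclideanSpace ℝ (Fin d) → ℝ}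

/-- Comparison with the barrier `M - m(t) η(x)`, where `m` solves a linear differential equation
driven by the mass of `M - u` in `B_R`. -/
theorem exists_le_sub_mul_bump (hd : 1 ≤ d) (hs₀ : 0 < s) (hs₁ : s < 1) (hlam : 0 < lam)
    (hLam : 0 < Lam) (hρ : 0 ≤ ρ) :
    ∃ C : ℝ, 0 ≤ C ∧ ∀ u : EuclideanSpace ℝ (Fin d) → ℝ → ℝ,
      IsSubsolutionUpToError s lam Lam ρ u →
      Continuous (fun p : EuclideanSpace ℝ (Fin d) × ℝ => u p.1 p.2) →
      ∀ B M : ℝ, (∀ x t, |u x t| ≤ B) → (∀ x t, u x t ≤ M) →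
      ∀ (k : ℕ) (R : ℝ), R = 2 ^ k → ρ ≤ R → ∀ (S : ℝ) (m : ℝ → ℝ), Differentiable ℝ m →
      m (-S) = 0 → (∀ t ∈ Icc (-S) 0, 0 ≤ m t) →
      (∀ t ∈ Icc (-S) 0, deriv m t =
        lam * (2 ^ (d + 1))⁻¹ * R ^ (-(d : ℝ) - 2 * s) * (∫ x in Metric.ball 0 R, (M - u x t))
        - (C * R ^ (-(2 * s)) + lam * (2 ^ (d + 1))⁻¹ * R ^ (-(d : ℝ) - 2 * s)
          * volume.real (Metric.ball (0 : EuclideanSpace ℝ (Fin d)) R)) * m t) →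
      ∀ x, ∀ t ∈ Icc (-S) 0, u x t ≤ M - m t * bump d R x := by
  obtain ⟨C, hC0, hC⟩ := exists_touching_inequality hd hs₀ hs₁ hlam hLam hρ
  refine ⟨C, hC0, ?_⟩
  intro u hu hcont B M hB hM k R hRk hρR S m hm hmS hm0 hmd x₁ t₁ ht₁
  have hR : 0 < R := by rw [hRk]; positivity
  have hS : 0 ≤ S := by linarith [ht₁.1, ht₁.2]
  by_contra! hcon
  set η := bump d R with hη
  have hη2 : ContDiff ℝ 2 η := contDiff_bump
  have hηc : Continuous η := hη2.continuous
  set γ := u x₁ t₁ - (M - m t₁ * η x₁) with hγ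
  have hγ0 : 0 < γ := by linarith
  -- A tilt in time, to make the inequality at the maximum strict; `δ S < γ` keeps `H` positive at
  -- `(x₁, t₁)`.
  set δ := γ / (2 * (S + 1)) with hδ
  have hδ0 : 0 < δ := by positivity
  have hδS : δ * S < γ := by
    rw [hδ, div_mul_eq_mul_div, div_lt_iff₀ (by positivity)]; nlinarith
  set H : EuclideanSpace ℝ (Fin d) × ℝ → ℝ :=
    fun p => u p.1 p.2 - M + m p.2 * η p.1 - δ * (p.2 + S) with hH
  have hHc : Continuous H := by
    have := hm.continuous
    fun_prop
  have hH1 : 0 < H (x₁, t₁) := by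
    have : δ * (t₁ + S) ≤ δ * S := by gcongr; linarith [ht₁.2]
    simp only [hH]
    linarith
  obtain ⟨Mm, hMm⟩ := isCompact_Icc.exists_bound_of_continuousOn
    (s := Icc (-S) 0) hm.continuous.continuousOn
  have hMm0 : 0 ≤ Mm := (norm_nonneg _).trans (hMm t₁ ht₁)
  -- Beyond radius `r` the term `m η` is smaller than `H (x₁, t₁)`, while `u - M ≤ 0`, so the
  -- maximum of `H` is attained in the closed ball.
  obtain ⟨r, hr⟩ := exists_bump_lt (d := d) hR
    (c := H (x₁, t₁) / (Mm + 1)) (by positivity)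
  have hout : ∀ x, ∀ t ∈ Icc (-S) 0, r < ‖x‖ → H (x, t) < H (x₁, t₁) := by
    intro x t ht hx
    have h1 := hr x hx
    rw [lt_div_iff₀ (by positivity)] at h1
    have h2 : m t ≤ Mm := (le_abs_self _).trans (hMm t ht)
    have h3 : 0 ≤ δ * (t + S) := mul_nonneg hδ0.le (by linarith [ht.1])
    have h4 := bump_pos (R := R) x
    have h5 := hM x t
    have h6 : m t * η x ≤ Mm * η x := by gcongr
    simp only [hH] at *
    nlinarith
  have hx₁ : ‖x₁‖ ≤ r := by
    by_contra! h
    exact lt_irrefl _ (hout x₁ t₁ ht₁ h)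
  obtain ⟨⟨x₀, t₀⟩, ⟨hx₀, ht₀⟩, hmax⟩ :=
    ((isCompact_closedBall (0 : EuclideanSpace ℝ (Fin d)) r).prod
      (isCompact_Icc (a := -S) (b := 0))).exists_isMaxOn
      ⟨(x₁, t₁), by simpa using hx₁, ht₁⟩ hHc.continuousOn
  have h10 : H (x₁, t₁) ≤ H (x₀, t₀) := hmax ⟨by simpa using hx₁, ht₁⟩
  have hmax' : ∀ x, ∀ t ∈ Icc (-S) 0, H (x, t) ≤ H (x₀, t₀) := by
    intro x t ht
    by_cases hx : ‖x‖ ≤ r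
    · exact hmax ⟨by simpa using hx, ht⟩
    · exact (hout x t ht (not_le.1 hx)).le.trans h10
  simp only at ht₀
  -- At the initial time `m = 0`, so `H = u - M ≤ 0` there.
  have htS : -S < t₀ := by
    refine lt_of_le_of_ne ht₀.1 fun h => ?_
    have h1 := hM x₀ t₀
    have h2 : H (x₀, t₀) = u x₀ t₀ - M := by simp [hH, ← h, hmS]
    linarith
  set L := H (x₀, t₀) with hL
  have hbd : ∀ t, HasDerivAt (fun t => M + L + δ * (t + S)) δ t := fun t => by
    simpa using (((hasDerivAt_id t).add_const S).const_mul δ).const_add (M + L)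
  -- Raised by the maximum `L` and tilted, the barrier touches `u` from above at `(x₀, t₀)`.
  have key := hC u hu (fun t _ => by fun_prop) B (fun x t _ => hB x t) k R hRk hρR
    (fun t => M + L + δ * (t + S)) m (fun t => (hbd t).differentiableAt) hm x₀ (-S) t₀ ht₀.2 htS
    (hm0 t₀ ht₀) (by simp only [hL, hH]; ring)
    (fun x t ht => by
      have := hmax' x t ⟨ht.1, ht.2.trans ht₀.2⟩
      simp only [hH] at this ⊢
      linarith)
  rw [(hbd t₀).deriv, hmd t₀ ht₀] at key
  set Q := lam * (2 ^ (d + 1))⁻¹ * R ^ (-(d : ℝ) - 2 * s) with hQ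
  have hQ0 : 0 < Q := by positivity
  set V := volume.real (Metric.ball (0 : EuclideanSpace ℝ (Fin d)) R) with hV
  have hint : ∀ f : EuclideanSpace ℝ (Fin d) → ℝ, Continuous f →
      IntegrableOn f (Metric.ball 0 R) := fun f hf =>
    (hf.continuousOn.integrableOn_compact (isCompact_closedBall 0 R)).mono_set
      Metric.ball_subset_closedBall
  -- With `η ≤ 1` and `L > 0`, the equation for `m` cancels every other term in `key` and leaves `δ
  -- ≤ 0`.
  have hJ : (∫ x in Metric.ball 0 R, (M - u x t₀)) - m t₀ * V
      ≤ ∫ x in Metric.ball 0 R, (M + L + δ * (t₀ + S) - m t₀ * η x - u x t₀) := by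
    have h1 : m t₀ * V = ∫ _ in Metric.ball (0 : EuclideanSpace ℝ (Fin d)) R, m t₀ := by
      rw [setIntegral_const, smul_eq_mul, mul_comm]
    rw [h1, ← integral_sub (hint _ (by fun_prop)) (hint _ (by fun_prop))]
    refine integral_mono (hint _ (by fun_prop)) (hint _ (by fun_prop)) fun x => ?_
    have h2 : m t₀ * η x ≤ m t₀ * 1 :=
      mul_le_mul_of_nonneg_left (bump_le_one x) (hm0 t₀ ht₀)
    have h3 : 0 ≤ δ * (t₀ + S) := mul_nonneg hδ0.le (by linarith)
    simp only
    linarith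
  have := mul_le_mul_of_nonneg_left hJ (mul_nonneg hQ0.le (bump_pos (R := R) x₀).le)
  simp only [← hη] at this key
  nlinarith

theorem continuous_setIntegral_ball {u : EuclideanSpace ℝ (Fin d) → ℝ → ℝ}
    (hu : Continuous fun p : EuclideanSpace ℝ (Fin d) × ℝ => u p.1 p.2) {B : ℝ}
    (hB : ∀ x t, |u x t| ≤ B) (R : ℝ) :
    Continuous fun t => ∫ x in Metric.ball 0 R, u x t := by
  refine continuous_of_dominated (bound := fun _ => B)
    (fun t => (by fun_prop : Continuous fun x => u x t).aestronglyMeasurable)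
    (fun t => Filter.Eventually.of_forall fun x => hB x t)
    (integrableOn_const measure_ball_lt_top.ne)
    (Filter.Eventually.of_forall fun x => by fun_prop)

/-- A weak Harnack inequality for `M - u` on large dyadic cylinders. -/
theorem exists_weak_harnack (hd : 1 ≤ d) (hs₀ : 0 < s) (hs₁ : s < 1) (hlam : 0 < lam)
    (hLam : 0 < Lam) (hρ : 0 ≤ ρ) :
    ∃ c : ℝ, 0 < c ∧ ∀ u : EuclideanSpace ℝ (Fin d) → ℝ → ℝ,
      IsSubsolutionUpToError s lam Lam ρ u →
      Continuous (fun p : EuclideanSpace ℝ (Fin d) × ℝ => u p.1 p.2) →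
      ∀ B M : ℝ, (∀ x t, |u x t| ≤ B) → (∀ x t, u x t ≤ M) →
      ∀ (k : ℕ) (R : ℝ), R = 2 ^ k → ρ ≤ R →
      ∀ x, ‖x‖ ≤ R → ∀ t ∈ Icc (-R ^ (2 * s)) 0,
      c * R ^ (-(d : ℝ) - 2 * s) *
        (∫ τ in (-(2 * R ^ (2 * s)))..(-R ^ (2 * s)), ∫ x in Metric.ball 0 R, (M - u x τ))
        ≤ M - u x t := by
  obtain ⟨C, hC0, hC⟩ := exists_le_sub_mul_bump hd hs₀ hs₁ hlam hLam hρ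
  set V₁ := volume.real (Metric.ball (0 : EuclideanSpace ℝ (Fin d)) 1) with hV₁
  set l := lam * (2 ^ (d + 1))⁻¹ with hl
  have hl0 : 0 < l := by positivity
  -- The exponential is the damping of the ODE over a time `2T`, and `2^(-(d+1))` is the least value
  -- of the barrier on `B_R`.
  refine ⟨l * Real.exp (-(2 * (C + l * V₁))) * (2 ^ (d + 1))⁻¹, by positivity, ?_⟩
  intro u hu hcont B M hB hM k R hRk hρR x hx t ht
  have hR : 0 < R := by rw [hRk]; positivity
  set T := R ^ (2 * s) with hT
  have hT0 : 0 < T := by positivity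
  set Q := l * R ^ (-(d : ℝ) - 2 * s) with hQ
  have hQ0 : 0 < Q := by positivity
  set P := C * R ^ (-(2 * s)) + Q * volume.real (Metric.ball (0 : EuclideanSpace ℝ (Fin d)) R)
    with hP
  -- Scale invariance: the total damping does not depend on `R`.
  have hPT : P * T = C + l * V₁ := by
    have h1 : R ^ (-(2 * s)) * T = 1 := by
      rw [hT, ← Real.rpow_add hR, neg_add_cancel, Real.rpow_zero]
    have h2 : R ^ (-(d : ℝ) - 2 * s) * R ^ d * T = 1 := by
      rw [hT, ← Real.rpow_natCast, ← Real.rpow_add hR, ← Real.rpow_add hR]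
      rw [show -(d : ℝ) - 2 * s + d + 2 * s = 0 by ring, Real.rpow_zero]
    rw [hP, hQ, volume_real_ball hd 0 hR.le]
    linear_combination C * h1 + l * V₁ * h2
  have hP0 : 0 ≤ P := by
    have : 0 ≤ P * T := by rw [hPT]; positivity
    exact nonneg_of_mul_nonneg_left this hT0
  set a : ℝ → ℝ := fun τ => ∫ x in Metric.ball 0 R, (M - u x τ) with ha
  have hac : Continuous a := continuous_setIntegral_ball (u := fun x t => M - u x t)
    (by fun_prop) (B := |M| + B) (fun x t => (abs_sub _ _).trans (by linarith [hB x t])) R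
  have ha0 : ∀ τ, 0 ≤ a τ := fun τ => integral_nonneg fun x => sub_nonneg.2 (hM x τ)
  have hgc : Continuous fun τ => Q * Real.exp (P * τ) * a τ := by fun_prop
  have hg0 : ∀ τ, 0 ≤ Q * Real.exp (P * τ) * a τ := fun τ => by
    have := ha0 τ
    positivity
  -- Variation of constants for `m' = Q a - P m` with `m (-2T) = 0`.
  set m : ℝ → ℝ := fun t => Real.exp (-(P * t)) *
    ∫ τ in (-(2 * T))..t, Q * Real.exp (P * τ) * a τ with hm
  have hmd : ∀ t, HasDerivAt m (Q * a t - P * m t) t := by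
    intro t
    have h1 : HasDerivAt (fun t => ∫ τ in (-(2 * T))..t, Q * Real.exp (P * τ) * a τ)
        (Q * Real.exp (P * t) * a t) t := (hgc.integral_hasStrictDerivAt _ t).hasDerivAt
    have h2 : HasDerivAt (fun t => Real.exp (-(P * t))) (Real.exp (-(P * t)) * (-P)) t := by
      simpa using (((hasDerivAt_id t).const_mul P).neg).exp
    refine (h2.mul h1).congr_deriv ?_
    have h3 : Real.exp (-(P * t)) * Real.exp (P * t) = 1 := by
      rw [← Real.exp_add, neg_add_cancel, Real.exp_zero]
    simp only [hm]
    linear_combination Q * a t * h3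
  have hconc := hC u hu hcont B M hB hM k R hRk hρR (2 * T) m
    (fun t => (hmd t).differentiableAt) (by simp [hm])
    (fun t ht => mul_nonneg (Real.exp_pos _).le
      (intervalIntegral.integral_nonneg ht.1 fun τ _ => hg0 τ))
    (fun t _ => (hmd t).deriv) x t ⟨by linarith [ht.1], ht.2⟩
  have hmt : Q * Real.exp (-(2 * (C + l * V₁))) * ∫ τ in (-(2 * T))..(-T), a τ ≤ m t := by
    have h1 : ∫ τ in (-(2 * T))..(-T), Q * Real.exp (-(2 * (C + l * V₁))) * a τ
        ≤ ∫ τ in (-(2 * T))..(-T), Q * Real.exp (P * τ) * a τ := by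
      refine intervalIntegral.integral_mono_on (by linarith)
        ((continuous_const.mul hac).intervalIntegrable _ _) (hgc.intervalIntegrable _ _) ?_
      intro τ hτ
      have := ha0 τ
      have h2 : -(2 * (C + l * V₁)) ≤ P * τ := by
        rw [← hPT]; nlinarith [hτ.1]
      gcongr
    rw [intervalIntegral.integral_const_mul] at h1
    have h2 : ∫ τ in (-(2 * T))..(-T), Q * Real.exp (P * τ) * a τ
        ≤ ∫ τ in (-(2 * T))..t, Q * Real.exp (P * τ) * a τ :=
      intervalIntegral.integral_mono_interval le_rfl (by linarith) ht.1
        (Filter.Eventually.of_forall hg0) (hgc.intervalIntegrable _ _)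
    have h3 : 0 ≤ ∫ τ in (-(2 * T))..t, Q * Real.exp (P * τ) * a τ :=
      intervalIntegral.integral_nonneg (by linarith [ht.1]) fun τ _ => hg0 τ
    have h4 : 1 ≤ Real.exp (-(P * t)) := Real.one_le_exp (by nlinarith [ht.2])
    exact (h1.trans h2).trans (le_mul_of_one_le_left h3 h4)
  have hI0 : 0 ≤ ∫ τ in (-(2 * T))..(-T), a τ :=
    intervalIntegral.integral_nonneg (by linarith) fun τ _ => ha0 τ
  have hfin : Q * Real.exp (-(2 * (C + l * V₁))) * (∫ τ in (-(2 * T))..(-T), a τ)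
      * (2 ^ (d + 1))⁻¹ ≤ m t * bump d R x := by
    have h1 := bump_ge_of_norm_le hR hx
    have h2 : 0 ≤ m t := le_trans (by positivity) hmt
    gcongr
  calc _ = Q * Real.exp (-(2 * (C + l * V₁))) * (∫ τ in (-(2 * T))..(-T), a τ)
      * (2 ^ (d + 1))⁻¹ := by rw [hQ]; ring
    _ ≤ _ := by linarith

/-- A bounded function that is a subsolution together with its negative is constant. -/
theorem eq_of_isSubsolutionUpToError (hd : 1 ≤ d) (hs₀ : 0 < s) (hs₁ : s < 1) (hlam : 0 < lam)
    (hLam : 0 < Lam) (hρ : 0 ≤ ρ) {u : EuclideanSpace ℝ (Fin d) → ℝ → ℝ}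
    (hu : IsSubsolutionUpToError s lam Lam ρ u)
    (hu' : IsSubsolutionUpToError s lam Lam ρ fun x t => -u x t)
    (hcont : Continuous (fun p : EuclideanSpace ℝ (Fin d) × ℝ => u p.1 p.2)) {B : ℝ}
    (hB : ∀ x t, |u x t| ≤ B) (hstat : ∀ x t, u x t = u x (min t 0)) :
    ∃ c, ∀ x t, u x t = c := by
  obtain ⟨c, hc, hH⟩ := exists_weak_harnack hd hs₀ hs₁ hlam hLam hρ
  set U : EuclideanSpace ℝ (Fin d) × ℝ → ℝ := fun p => u p.1 p.2 with hU
  have hcont : Continuous fun p : EuclideanSpace ℝ (Fin d) × ℝ => u p.1 p.2 := hcont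
  have hba : BddAbove (range U) := ⟨B, by rintro _ ⟨p, rfl⟩; exact (abs_le.1 (hB _ _)).2⟩
  have hbb : BddBelow (range U) := ⟨-B, by rintro _ ⟨p, rfl⟩; exact (abs_le.1 (hB _ _)).1⟩
  set M := ⨆ p, U p with hM
  set M' := ⨅ p, U p with hM'
  have hleM : ∀ x t, u x t ≤ M := fun x t => le_ciSup hba (x, t)
  have hM'le : ∀ x t, M' ≤ u x t := fun x t => ciInf_le hbb (x, t)
  have hV : 0 < volume.real (Metric.ball (0 : EuclideanSpace ℝ (Fin d)) 1) :=
    ENNReal.toReal_pos (Metric.measure_ball_pos volume _ one_pos).ne' measure_ball_lt_top.ne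
  set V := volume.real (Metric.ball (0 : EuclideanSpace ℝ (Fin d)) 1)
  have hosc : ∀ p q : EuclideanSpace ℝ (Fin d) × ℝ,
      c * V * (M - M') ≤ (M - U p) + (U q - M') := by
    rintro ⟨x, t⟩ ⟨x', t'⟩
    -- One large cylinder captures both points, and beyond scale `ρ` the truncation of the lower
    -- kernel bound is harmless.
    have hlarge : ∀ᶠ k : ℕ in Filter.atTop, ρ ≤ (2 : ℝ) ^ k ∧ ‖x‖ ≤ 2 ^ k ∧ ‖x'‖ ≤ 2 ^ k ∧
        -(min t 0) ≤ ((2 : ℝ) ^ k) ^ (2 * s) ∧ -(min t' 0) ≤ ((2 : ℝ) ^ k) ^ (2 * s) := by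
      have h1 : Filter.Tendsto (fun k : ℕ => (2 : ℝ) ^ k) Filter.atTop Filter.atTop :=
        tendsto_pow_atTop_atTop_of_one_lt (by norm_num)
      have h2 := (tendsto_rpow_atTop (by linarith : 0 < 2 * s)).comp h1
      filter_upwards [h1.eventually_ge_atTop ρ, h1.eventually_ge_atTop ‖x‖,
        h1.eventually_ge_atTop ‖x'‖, h2.eventually_ge_atTop (-(min t 0)),
        h2.eventually_ge_atTop (-(min t' 0))] with k a1 a2 a3 a4 a5
      exact ⟨a1, a2, a3, a4, a5⟩
    obtain ⟨k, k1, k2, k3, k4, k5⟩ := hlarge.exists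
    obtain ⟨R, hRk⟩ : ∃ R : ℝ, R = 2 ^ k := ⟨_, rfl⟩
    rw [← hRk] at k1 k2 k3 k4 k5
    have hR : 0 < R := by rw [hRk]; positivity
    have e₁ := hH u hu hcont B M hB hleM k R hRk k1 x k2 (min t 0)
      ⟨by linarith, min_le_right _ _⟩
    have e₂ := hH (fun x t => -u x t) hu' hcont.neg B (-M') (fun x t => by rw [abs_neg]; exact hB x t)
      (fun x t => neg_le_neg (hM'le x t)) k R hRk k1 x' k3 (min t' 0)
      ⟨by linarith, min_le_right _ _⟩
    rw [← hstat] at e₁ e₂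
    set T := R ^ (2 * s) with hT
    have hint : ∀ f : EuclideanSpace ℝ (Fin d) → ℝ, Continuous f →
        IntegrableOn f (Metric.ball 0 R) := fun f hf =>
      (hf.continuousOn.integrableOn_compact (isCompact_closedBall 0 R)).mono_set
        Metric.ball_subset_closedBall
    have hsum : (∫ τ in (-(2 * T))..(-T), ∫ x in Metric.ball 0 R, (M - u x τ))
        + (∫ τ in (-(2 * T))..(-T), ∫ x in Metric.ball 0 R, (-M' - -u x τ))
        = T * (R ^ d * V * (M - M')) := by
      rw [← intervalIntegral.integral_add]
      · have h1 : ∀ τ, (∫ x in Metric.ball 0 R, (M - u x τ))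
            + (∫ x in Metric.ball 0 R, (-M' - -u x τ)) = R ^ d * V * (M - M') := by
          intro τ
          rw [← integral_add (hint _ (by fun_prop)) (hint _ (by fun_prop))]
          have h2 : ∀ x, M - u x τ + (-M' - -u x τ) = M - M' := fun x => by ring
          simp only [h2]
          rw [setIntegral_const, volume_real_ball hd 0 hR.le, smul_eq_mul]
        simp only [h1]
        rw [intervalIntegral.integral_const, smul_eq_mul]
        ring
      · exact (continuous_setIntegral_ball (u := fun x t => M - u x t)
          (by fun_prop) (B := |M| + B)
          (fun x t => (abs_sub _ _).trans (by linarith [hB x t])) R).intervalIntegrable _ _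
      · exact (continuous_setIntegral_ball (u := fun x t => -M' - -u x t)
          (by fun_prop) (B := |-M'| + B)
          (fun x t => (abs_sub _ _).trans (by rw [abs_neg (u x t)]; linarith [hB x t])) R).intervalIntegrable _ _
    have hone : R ^ (-(d : ℝ) - 2 * s) * R ^ d * T = 1 := by
      rw [hT, ← Real.rpow_natCast, ← Real.rpow_add hR, ← Real.rpow_add hR]
      rw [show -(d : ℝ) - 2 * s + d + 2 * s = 0 by ring, Real.rpow_zero]
    have e₃ := add_le_add e₁ e₂
    rw [← mul_add, hsum] at e₃
    calc c * V * (M - M') = c * R ^ (-(d : ℝ) - 2 * s) * (T * (R ^ d * V * (M - M'))) := by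
          linear_combination -(c * V * (M - M')) * hone
      _ ≤ _ := e₃
      _ = _ := by simp only [hU]; ring
  -- The infimum over `q` and the supremum over `p` in `hosc` give `c V (M - M') ≤ 0`.
  have hMM : M ≤ M' := by
    have h1 : ∀ p, U p ≤ M - c * V * (M - M') := by
      intro p
      have h2 : ∀ q, c * V * (M - M') - (M - U p) + M' ≤ U q := fun q => by linarith [hosc p q]
      have h3 : c * V * (M - M') - (M - U p) + M' ≤ M' := le_ciInf h2
      linarith
    have h2 : M ≤ M - c * V * (M - M') := ciSup_le h1
    have h3 : 0 < c * V := by positivity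
    by_contra! h
    nlinarith [mul_pos h3 (sub_pos.2 h)]
  exact ⟨M, fun x t => le_antisymm (hleM x t) (hMM.trans (hM'le x t))⟩

/-- An essentially bounded function that is continuous up to the final time is bounded. -/
theorem exists_bound_of_memLp_top {v : EuclideanSpace ℝ (Fin d) → ℝ → ℝ}
    (hv : Continuous fun p : EuclideanSpace ℝ (Fin d) × ℝ => v p.1 p.2)
    (h : MemLp (fun p : EuclideanSpace ℝ (Fin d) × ℝ => v p.1 p.2) ∞
      (volume.restrict (univ ×ˢ Iic 0))) :
    ∃ B : ℝ, ∀ x, ∀ t ≤ 0, |v x t| ≤ B := by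
  set f : EuclideanSpace ℝ (Fin d) × ℝ → ℝ := fun p => v p.1 p.2 with hf
  set N := eLpNormEssSup f (volume.restrict (univ ×ˢ Iic 0)) with hN
  have hfin : N ≠ ∞ := by
    have := h.2.ne
    rwa [eLpNorm_exponent_top] at this
  have hae : ∀ᵐ p ∂(volume.restrict (univ ×ˢ Iic 0)), |f p| ≤ N.toReal := by
    filter_upwards [ae_le_eLpNormEssSup (f := f) (μ := volume.restrict (univ ×ˢ Iic 0))] with p hp
    have := ENNReal.toReal_mono hfin hp
    rwa [toReal_enorm, Real.norm_eq_abs] at this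
  have hclosed : IsClosed {p | |f p| ≤ N.toReal} := isClosed_le hv.abs continuous_const
  have hopen : IsOpen ((univ : Set (EuclideanSpace ℝ (Fin d))) ×ˢ Iio (0 : ℝ)) :=
    isOpen_univ.prod isOpen_Iio
  -- A bound holding almost everywhere holds everywhere on the open set `t < 0` by continuity, and
  -- passes to `t = 0` by closure.
  have hsub : (univ : Set (EuclideanSpace ℝ (Fin d))) ×ˢ Iio (0 : ℝ)
      ⊆ {p | |f p| ≤ N.toReal} := by
    rw [← sdiff_eq_empty]
    refine IsOpen.eq_empty_of_measure_zero (μ := volume)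
      (hopen.inter hclosed.isOpen_compl) ?_
    rw [ae_restrict_iff' (MeasurableSet.univ.prod measurableSet_Iic)] at hae
    refine measure_mono_null ?_ (ae_iff.1 hae)
    rintro p ⟨hp, hp2⟩
    simp only [mem_ofPred_eq, not_forall]
    exact ⟨⟨hp.1, mem_Iic.2 (mem_Iio.1 hp.2).le⟩, hp2⟩
  refine ⟨N.toReal, fun x t ht => ?_⟩
  have := closure_minimal hsub hclosed
  rw [closure_prod_eq, closure_univ, closure_Iio] at this
  exact this (show (x, t) ∈ univ ×ˢ Iic 0 from ⟨mem_univ _, ht⟩)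

end

theorem mainTheorem6 (d : ℕ) (hd : 1 ≤ d) (s : ℝ) (hs₀ : 0 < s) (hs₁ : s < 1)
    (lam Lam : ℝ) (hlam : 0 < lam) (hLam : 0 < Lam) (ρ : ℝ) (hρ : 0 ≤ ρ)
    (u : EuclideanSpace ℝ (Fin d) → ℝ → ℝ)
    (hsub : IsViscositySubsolution (pucciSup s lam Lam ρ) (fun _ _ => 0) univ (Iic 0) u)
    (hsup : IsViscositySupersolution (pucciInf s lam Lam ρ) (fun _ _ => 0) univ (Iic 0) u) :
    ∃ c : ℝ, ∀ x : EuclideanSpace ℝ (Fin d), ∀ t : ℝ, t ≤ 0 → u x t = c := by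
  have hcontOn : ContinuousOn (fun p : EuclideanSpace ℝ (Fin d) × ℝ => u p.1 p.2)
      (univ ×ˢ Iic 0) :=
    continuousOn_iff_lower_upperSemicontinuousOn.2
      ⟨hsup.lowerSemicontinuousOn, hsub.upperSemicontinuousOn⟩
  -- Freezing `u` after time `0` gives a function continuous on all of space-time; the subsolution
  -- property only sees `t ≤ 0`.
  set v : EuclideanSpace ℝ (Fin d) → ℝ → ℝ := fun x t => u x (min t 0) with hv
  have huv : ∀ x, ∀ t ≤ 0, u x t = v x t := fun x t ht => by simp [hv, ht]
  have hvc : Continuous fun p : EuclideanSpace ℝ (Fin d) × ℝ => v p.1 p.2 :=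
    hcontOn.comp_continuous (f := fun p : EuclideanSpace ℝ (Fin d) × ℝ => (p.1, min p.2 0))
      (by fun_prop) fun p => ⟨mem_univ _, mem_Iic.2 (min_le_right _ _)⟩
  obtain ⟨B, hB⟩ := exists_bound_of_memLp_top hvc (hsub.memLp_top.ae_eq (by
    filter_upwards [ae_restrict_mem (MeasurableSet.univ.prod measurableSet_Iic)] with p hp
    exact huv _ _ hp.2))
  obtain ⟨c, hc⟩ := eq_of_isSubsolutionUpToError hd hs₀ hs₁ hlam hLam hρ
    (hsub.isSubsolutionUpToError.congr huv)
    (hsup.isSubsolutionUpToError_neg.congr fun x t ht => by rw [huv x t ht]) hvc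
    (B := B) (fun x t => by
      have := hB x (min t 0) (min_le_right _ _)
      simpa [hv] using this) (fun x t => by simp [hv])
  exact ⟨c, fun x t ht => (huv x t ht).trans (hc x t)⟩

end
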